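/- Let $Z\subseteq\mathbb{C}$ be a simply connected domain on which $f,g,p$ are holomorphic, and consider $$w''(z)-\{u^{2}f(z)+g(z)\}\,w(z)=p(z),\qquad z\in Z. \tag{1}$$ Let $D\subseteq Z$ be an open set on which $f$ has no zeros (in particular $D$ does not contain a turning point) and on which there are holomorphic branches of $\xi=\int f^{1/2}(z)\,dz$ and of $f^{1/4}$. Functions on $D$ are regarded as functions of $\xi$: for such functions a prime denotes $d/d\xi=f^{-1/2}\,d/dz$. Put $$\psi=\frac{4ff_{zz}-5f_z^{2}}{16f^{3}}+\frac{g}{f},\qquad G_{0}=-f^{-3/4}p,\qquad G_{s+1}=G_{s}''-\psi\,G_{s}\quad(s=0,1,2,\ldots).$$ Let $u\in\mathbb{C}$, $c\in\mathbb{R}$, $n\in\{0,1,2,\ldots\}$. Let $\mathcal{L}_c$ be a path in $D$, described by its $\xi$ points $t$, that joins two reference points $\xi^{(j)}$ and $\xi^{(k)}$ at infinity. It consists of a finite chain of $R_2$ arcs (twice continuously differentiable arcs with non-vanishing derivative). As $t$ passes along it from $\xi^{(j)}$ to $\xi^{(k)}$, both $\Re\{(u+c)t\}$ and $\Re\{(u-c)t\}$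 are monotonic (non-decreasing), with $\Re\{(u+c)t\}\to-\infty$ at $\xi^{(j)}$ and $\Re\{(u-c)t\}\to+\infty$ at $\xi^{(k)}$. Suppose that on $\mathcal{L}_c$, as $t$ tends to either end, $e^{-ct}G_{n}(t)=\mathcal{O}(1)$ and $\{e^{-ct}G_{n}(t)\}'=\mathcal{O}(|t|^{-\sigma})$ for some $\sigma>1$; that the integrals $\int_{\mathcal{L}_c}|\{e^{-ct}G_n(t)\}'\,dt|$ and $\int_{\mathcal{L}_c}|\psi(t)\,dt|$ converge; and that $$\max\Bigl\{|c|,\ \tfrac12\int_{\mathcal{L}_c}|\psi(t)\,dt|\Bigr\}<|u|<\infty .$$ Then there exists a unique solution $w$ of (1), holomorphic on $Z$, which on $D$ has the form $$w=\frac{1}{f^{1/4}(z)}\left[\frac{1}{u^{2}}\sum_{s=0}^{n-1}\frac{G_{s}(\xi)}{u^{2s}}+\varepsilon_{n}(u,\xi)\right],$$ where for every point $\xi$ of $\mathcal{L}_c$ $$\begin{aligned}|\varepsilon_{n}(u,\xi)|\le{}&\frac{1}{|u|^{2n+2}}\left\{\left|\frac{u^{2}G_{n}(\xi)}{u^{2}-c^{2}}\right|+\frac{|u\,e^{c\xi}|}{2(|u|-|c|)}\int_{\mathcal{L}_c}\bigl|\{e^{-ct}G_{n}(t)\}'\,dt\bigr|\right\}\\&+\frac{|e^{c\xi}|\,L_{c,n}(u)}{2|u|^{2n+3}}\left\{1-\frac{1}{2|u|}\int_{\mathcal{L}_c}|\psi(t)\,dt|\right\}^{-1}\int_{\mathcal{L}_c}|\psi(t)\,dt|,\end{aligned}$$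 with $$L_{c,n}(u)=\left|\frac{u^{2}}{u^{2}-c^{2}}\right|\sup_{t\in\mathcal{L}_c}\bigl|e^{-ct}G_{n}(t)\bigr|+\frac{|u|}{2(|u|-|c|)}\int_{\mathcal{L}_c}\bigl|\{e^{-ct}G_{n}(t)\}'\,dt\bigr|.$$ -/

import Mathlib

open Filter Topology

noncomputable section

namespace LiouvilleGreen

/-- The equation `w'' - (u² f(z) + g(z)) w = p(z)`: `w` is holomorphic on the open set `Z` and
satisfies the equation at every point of `Z`. -/
def IsParticularSolution (Z : Set ℂ) (f g p : ℂ → ℂ) (u : ℂ) (w : ℂ → ℂ) : Prop :=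
  DifferentiableOn ℂ w Z ∧
    ∀ z ∈ Z, deriv (deriv w) z - (u ^ 2 * f z + g z) * w z = p z

/-- A Liouville variable on the open set `D`: `ξ` is a holomorphic branch of `∫ f^{1/2}(z) dz`
and `q` is a holomorphic branch of `f^{1/4}`, where `f` has no zeros in `D`. The additive constant
in `ξ` is left free: no quantity below changes, apart from the harmless comparison function
`|ξ|^{-σ}` at infinity, when a constant is added to `ξ`; so `ξ = ∫_{z₀}^z f^{1/2}` is included. -/
structure IsLiouvilleVariable (D : Set ℂ) (f ξ q : ℂ → ℂ) : Prop where
  differentiableOn_xi : DifferentiableOn ℂ ξ D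
  differentiableOn_q : DifferentiableOn ℂ q D
  ne_zero : ∀ z ∈ D, f z ≠ 0
  deriv_xi_sq : ∀ z ∈ D, deriv ξ z ^ 2 = f z
  q_pow_four : ∀ z ∈ D, q z ^ 4 = f z

/-- Functions of `ξ` are written as functions of `z` through `ξ = ξ(z)`. For such a function `h`,
this is its derivative with respect to `ξ`, that is `(dh/dz) / (dξ/dz)`. -/
def derivXi (ξ h : ℂ → ℂ) (z : ℂ) : ℂ := deriv h z / deriv ξ z

/-- `ψ(ξ) = Φ(z) = (4 f f'' - 5 f'²) / (16 f³) + g / f`. -/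
def psi (f g : ℂ → ℂ) (z : ℂ) : ℂ :=
  (4 * f z * deriv (deriv f) z - 5 * deriv f z ^ 2) / (16 * f z ^ 3) + g z / f z

/-- The coefficients `G₀ = -f^{-3/4} p` and `G_{s+1} = G_s'' - ψ G_s`, where the primes are
derivatives with respect to `ξ`. -/
def coeff (f g p ξ q : ℂ → ℂ) : ℕ → ℂ → ℂ
  | 0 => fun z => -(p z / q z ^ 3)
  | s + 1 => fun z =>
      derivXi ξ (derivXi ξ (coeff f g p ξ q s)) z - psi f g z * coeff f g p ξ q s z

/-- The function `e^{-cξ} G_n(ξ)`. -/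
def scaledCoeff (f g p ξ q : ℂ → ℂ) (c : ℝ) (n : ℕ) (z : ℂ) : ℂ :=
  Complex.exp (-(c : ℂ) * ξ z) * coeff f g p ξ q n z

/-- A path consisting of a finite chain of `R₂` arcs, parametrized by the open interval `ℝ`: there
are finitely many break points, and on every closed parameter interval without a break point in
its interior the path is twice continuously differentiable with non-vanishing derivative
(one-sided at the end points). -/
structure IsR2Path (γ : ℝ → ℂ) : Prop where
  continuous : Continuous γ
  arcs : ∃ S : Finset ℝ, ∀ a b : ℝ, a < b → (∀ τ ∈ Set.Ioo a b, τ ∉ S) →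
    ContDiffOn ℝ 2 γ (Set.Icc a b) ∧
      ∀ τ ∈ Set.Icc a b, derivWithin γ (Set.Icc a b) τ ≠ 0

/-- The admissible paths for the exponent `c`. The path is an `R₂` path in `D`, described by its
`z` points; `-∞` and `+∞` are the parameters of the reference points `ξ^{(j)}` and `ξ^{(k)}`.
Along it the real parts of `(u + c) ξ` and `(u - c) ξ` are monotonic, and they tend to `-∞` at
`ξ^{(j)}` and to `+∞` at `ξ^{(k)}`, respectively. Since both are non-decreasing,
`Re (u ξ)` tends to `-∞` at `ξ^{(j)}` and to `+∞` at `ξ^{(k)}`. -/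
structure IsProgressivePath (D : Set ℂ) (ξ : ℂ → ℂ) (u : ℂ) (c : ℝ) (γ : ℝ → ℂ) : Prop where
  isR2Path : IsR2Path γ
  mem : ∀ τ, γ τ ∈ D
  monotone_add : Monotone fun τ => ((u + c) * ξ (γ τ)).re
  monotone_sub : Monotone fun τ => ((u - c) * ξ (γ τ)).re
  tendsto_start : Tendsto (fun τ => ((u + c) * ξ (γ τ)).re) atBot atBot
  tendsto_end : Tendsto (fun τ => ((u - c) * ξ (γ τ)).re) atTop atTop

/-- The integrand of `∫ |h(t) dt|`, where `t = ξ(γ(τ))`. -/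
def pathDensity (ξ : ℂ → ℂ) (γ : ℝ → ℂ) (h : ℂ → ℂ) (τ : ℝ) : ℝ :=
  ‖h (γ τ)‖ * ‖deriv (fun s => ξ (γ s)) τ‖

/-- The integral `∫ |h(t) dt|` converges along the path. -/
def PathIntegrable (ξ : ℂ → ℂ) (γ : ℝ → ℂ) (h : ℂ → ℂ) : Prop :=
  MeasureTheory.Integrable (pathDensity ξ γ h)

/-- The integral `∫ |h(t) dt|` along the path, in the variable `t = ξ`. -/
def pathIntegral (ξ : ℂ → ℂ) (γ : ℝ → ℂ) (h : ℂ → ℂ) : ℝ :=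
  ∫ τ, pathDensity ξ γ h τ

/-- `L_{c,n}(u, ξ)`. -/
def boundL (f g p ξ q : ℂ → ℂ) (u : ℂ) (c : ℝ) (n : ℕ) (γ : ℝ → ℂ) : ℝ :=
  ‖u ^ 2 / (u ^ 2 - (c : ℂ) ^ 2)‖ * (⨆ τ : ℝ, ‖scaledCoeff f g p ξ q c n (γ τ)‖)
    + ‖u‖ / (2 * (‖u‖ - |c|)) * pathIntegral ξ γ (derivXi ξ (scaledCoeff f g p ξ q c n))

/-- The bound for the error term at the point `z` of the path `γ`. -/
def errorBound (f g p ξ q : ℂ → ℂ) (u : ℂ) (c : ℝ) (n : ℕ) (γ : ℝ → ℂ) (z : ℂ) : ℝ :=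
  1 / ‖u‖ ^ (2 * n + 2) *
      (‖u ^ 2 * coeff f g p ξ q n z / (u ^ 2 - (c : ℂ) ^ 2)‖
        + ‖u * Complex.exp (c * ξ z)‖ / (2 * (‖u‖ - |c|))
          * pathIntegral ξ γ (derivXi ξ (scaledCoeff f g p ξ q c n)))
    + ‖Complex.exp (c * ξ z)‖ * boundL f g p ξ q u c n γ / (2 * ‖u‖ ^ (2 * n + 3))
        * (1 - 1 / (2 * ‖u‖) * pathIntegral ξ γ (psi f g))⁻¹
        * pathIntegral ξ γ (psi f g)

/-- `w = f^{-1/4} [u^{-2} ∑_{s<n} G_s u^{-2s} + ε]` on `D`. -/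
def HasExpansion (D : Set ℂ) (f g p ξ q : ℂ → ℂ) (u : ℂ) (n : ℕ) (w ε : ℂ → ℂ) : Prop :=
  ∀ z ∈ D, w z =
    1 / q z * (1 / u ^ 2 * ∑ s ∈ Finset.range n, coeff f g p ξ q s z / u ^ (2 * s) + ε z)

/-- `w` is a particular solution of the equation in `Z` that has the expansion with `n` terms on
`D`, with an error term that satisfies the error bound at every point of the path. -/
def IsBoundedSolution (Z D : Set ℂ) (f g p ξ q : ℂ → ℂ) (u : ℂ) (c : ℝ) (n : ℕ) (γ : ℝ → ℂ)
    (w : ℂ → ℂ) : Prop :=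
  IsParticularSolution Z f g p u w ∧
    ∃ ε : ℂ → ℂ, HasExpansion D f g p ξ q u n w ε ∧
      ∀ τ : ℝ, ‖ε (γ τ)‖ ≤ errorBound f g p ξ q u c n γ (γ τ)

end LiouvilleGreen

end

/-! Put `ε = f^{1/4} w - u⁻² ∑_{s<n} G_s u^{-2s}`. The Liouville transformation turns the equation
into `ε'' = (u² + ψ) ε - u^{-2n} G_n` with primes `d/dξ`; the recursion for `G_s` is exactly what
preserves this form when a term is split off. Along the path, `h = e^{-cξ} ε` and `k = e^{-cξ} ε'`
satisfy a first order linear system (`IsPathSolution`).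

Without `ψ`, variation of parameters gives integrals over the path after and before the current
point, whose exponential kernels have modulus at most one because `Re ((u - c) ξ)` and `Re ((u + c)
ξ)` are monotone. One integration by parts exposes the term `H / (u² - c²)` and leaves integrals of
`dH/dξ` only. The term `ψ h` contributes the operator `pathKernel`, of norm at most `κ = ∫ |ψ dt| /
(2|u|) < 1` on bounded continuous functions, so the contraction principle yields a bounded `h` and
its estimate (`IsPiecewiseC1.exists_isPathSolution`). Conversely, a bounded homogeneous solution
minus its image under the operator is a combination of `e^{(u-c)ξ}` and `e^{-(u+c)ξ}`. Growth at the
two ends kills both, and `κ < 1` then forces zero (`IsPathSolution.eq_zero_of_bounded`).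

The passage to `Z` rests on global solvability of linear holomorphic equations on simply connected
domains (`exists_hasDerivAt_linear_second_order`). The solution that shares the data of `h` at one
point of the path agrees with `h` along the whole path by a Grönwall argument. Two solutions with
the error bound agree on the path, hence on `Z` by the identity theorem. -/

/-! ### Primitives on simply connected domains, by covering spaces -/

/-- On a simply connected, locally path connected space, local functions on an open cover that
differ by locally constant functions can be glued, up to locally constant functions. -/
theorem SimplyConnectedSpace.exists_glue_of_sub_locallyConst {X G : Type*} [TopologicalSpace X]
    [SimplyConnectedSpace X] [LocallyPathConnectedSpace X] [AddCommGroup G]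
    (U : X → Set X) (hU : ∀ x, IsOpen (U x)) (hxU : ∀ x, x ∈ U x) (F : X → X → G)
    (hF : ∀ x y, ∀ z ∈ U x ∩ U y, ∀ᶠ w in 𝓝 z, F x w - F y w = F x z - F y z) :
    ∃ g : X → G, ∀ x, ∀ᶠ w in 𝓝 x, g w - F x w = g x - F x x := by
  -- With discrete fibres the bundle is a covering, and a continuous section is locally constant in
  -- each chart.
  let _ : TopologicalSpace G := ⊥
  have : DiscreteTopology G := ⟨rfl⟩
  let C : FiberBundleCore X X G :=
    { baseSet := U
      isOpen_baseSet := hU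
      indexAt := id
      mem_baseSet_at := hxU
      -- A fibre value in chart `i` stands for the sought function minus `F i`.
      coordChange := fun i j x v => v + (F i x - F j x)
      coordChange_self := fun i x _ v => by simp
      continuousOn_coordChange := by
        rintro i j ⟨x, v⟩ hx
        refine ContinuousAt.continuousWithinAt ?_
        refine (continuousAt_const (y := v + (F i x - F j x))).congr ?_
        have h1 : ∀ᶠ q : X × G in 𝓝 (x, v), F i q.1 - F j q.1 = F i x - F j x :=
          (continuous_fst.tendsto (x, v)).eventually (hF i j x hx.1)
        have h2 : ∀ᶠ q : X × G in 𝓝 (x, v), q.2 = v :=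
          (continuous_snd.tendsto (x, v)).eventually (p := fun a : G => a = v) (by simp)
        filter_upwards [h1, h2] with q hq1 hq2
        rw [hq1, hq2]
      coordChange_comp := fun i j k x _ v => by abel }
  have hcov : IsCoveringMap (Bundle.TotalSpace.proj : C.TotalSpace → X) :=
    FiberBundle.isCoveringMap
  obtain ⟨x₀⟩ : Nonempty X := inferInstance
  -- Lifting the identity of a simply connected base gives a global section.
  obtain ⟨s, ⟨-, hs⟩, -⟩ := hcov.existsUnique_continuousMap_lifts (ContinuousMap.id X) x₀
    ⟨x₀, (0 : G)⟩ rfl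
  have hproj : ∀ x, (s x).1 = x := fun x => congrFun hs x
  -- The fibre over `x` is read in the chart indexed by `x` itself, so adding `F x x` recovers the
  -- glued value.
  refine ⟨fun x => (show G from (s x).2) + F (s x).1 (s x).1, fun x => ?_⟩
  have hc : ContinuousAt (fun w => (C.localTriv x (s w)).2) x := by
    have h1 : ContinuousAt (C.localTriv x) (s x) := by
      refine (C.localTriv x).continuousOn_toFun.continuousAt
        ((C.localTriv x).open_source.mem_nhds ?_)
      change (s x).1 ∈ U x
      rw [hproj]; exact hxU x
    exact continuousAt_snd.comp (h1.comp s.continuous.continuousAt)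
  have h2 : ∀ᶠ w in 𝓝 x, (C.localTriv x (s w)).2 = (C.localTriv x (s x)).2 :=
    hc.eventually (p := fun a : G => a = (C.localTriv x (s x)).2) (by simp)
  filter_upwards [h2] with w hw
  have key : ∀ w, (C.localTriv x (s w)).2
      = (show G from (s w).2) + (F (s w).1 (s w).1 - F x (s w).1) := fun w => rfl
  rw [key, key] at hw
  rw [hproj w, hproj x] at hw ⊢
  rw [sub_self, add_zero] at hw
  rw [add_sub_assoc, hw, add_sub_cancel_right]

/-- A holomorphic function on a simply connected open set has a primitive. -/
theorem DifferentiableOn.exists_primitive_of_isSimplyConnected {E : Type*} [NormedAddCommGroup E]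
    [NormedSpace ℂ E] [CompleteSpace E] {Z : Set ℂ} (hZ : IsOpen Z) (hZsc : IsSimplyConnected Z)
    {f : ℂ → E} (hf : DifferentiableOn ℂ f Z) : Complex.IsExactOn f Z := by
  classical
  have := hZsc.simplyConnectedSpace
  have : LocallyPathConnectedSpace Z := hZ.locallyPathConnectedSpace
  have hball : ∀ x : Z, ∃ r > 0, Metric.ball (x : ℂ) r ⊆ Z := fun x =>
    Metric.isOpen_iff.1 hZ x x.2
  choose r hr hrZ using hball
  have hprim : ∀ x : Z, Complex.IsExactOn f (Metric.ball (x : ℂ) (r x)) := fun x =>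
    DifferentiableOn.isExactOn_ball (hf.mono (hrZ x))
  choose F hF using hprim
  obtain ⟨g, hg⟩ := SimplyConnectedSpace.exists_glue_of_sub_locallyConst
    (fun x : Z => (Subtype.val ⁻¹' Metric.ball (x : ℂ) (r x) : Set Z))
    (fun x => Metric.isOpen_ball.preimage continuous_subtype_val)
    (fun x => Metric.mem_ball_self (hr x)) (fun x w => F x w) (by
      intro x y z hz
      obtain ⟨ρ, hρ, hρs⟩ := Metric.isOpen_iff.1
        ((Metric.isOpen_ball (x := (x : ℂ)) (ε := r x)).inter
          (Metric.isOpen_ball (x := (y : ℂ)) (ε := r y))) z hz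
      have hconst : ∀ w ∈ Metric.ball (z : ℂ) ρ, F x w - F y w = F x z - F y z := by
        intro w hw
        refine (convex_ball (z : ℂ) ρ).is_const_of_fderivWithin_eq_zero (𝕜 := ℂ)
          (f := fun w => F x w - F y w) ?_ ?_ hw (Metric.mem_ball_self hρ)
        · intro v hv
          exact ((hF x v (hρs hv).1).sub (hF y v (hρs hv).2)).differentiableAt.differentiableWithinAt
        · intro v hv
          have := ((hF x v (hρs hv).1).sub (hF y v (hρs hv).2)).hasFDerivAt.hasFDerivWithinAt
            (s := Metric.ball (z : ℂ) ρ)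
          have h2 := this.fderivWithin (Metric.isOpen_ball.uniqueDiffWithinAt hv)
          simp only [sub_self] at h2
          convert! h2 using 1
          ext; simp
      exact continuous_subtype_val.continuousAt.eventually
        (Filter.eventually_of_mem (Metric.ball_mem_nhds _ hρ) hconst))
  refine ⟨fun z => if hz : z ∈ Z then g ⟨z, hz⟩ else 0, fun z hz => ?_⟩
  have h1 := hg ⟨z, hz⟩
  rw [nhds_subtype_eq_comap, eventually_comap] at h1
  refine ((hF ⟨z, hz⟩ z (Metric.mem_ball_self (hr _))).add_const
    (g ⟨z, hz⟩ - F ⟨z, hz⟩ z)).congr_of_eventuallyEq ?_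
  filter_upwards [h1, hZ.mem_nhds hz] with w hw hwZ
  have := hw ⟨w, hwZ⟩ rfl
  simp only [hwZ, dif_pos]
  rw [← this]; abel

/-! ### Global solutions of linear holomorphic equations -/

/-- Summing the recursion gives `∑ m ≤ m 0 + ∑ e + (∑ m) / 2`, and the last term is absorbed on the
left. -/
theorem summable_of_succ_le_add_half {m e : ℕ → ℝ} (hm : ∀ k, 0 ≤ m k) (he : ∀ k, 0 ≤ e k)
    (hes : Summable e) (h : ∀ k, m (k + 1) ≤ e (k + 1) + m k / 2) : Summable m := by
  refine summable_of_sum_range_le (c := 2 * (m 0 + ∑' k, e k)) hm fun n => ?_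
  have h1 : ∀ n, ∑ i ∈ Finset.range n, m i
      ≤ m 0 + ∑ i ∈ Finset.range n, e i + (∑ i ∈ Finset.range n, m i) / 2 := by
    have h2 : ∀ n, ∑ i ∈ Finset.range (n + 1), m i
        ≤ m 0 + ∑ i ∈ Finset.range (n + 1), e i + (∑ i ∈ Finset.range n, m i) / 2 := by
      intro n
      induction n with
      | zero => simp [he 0]
      | succ n ih =>
        simp only [Finset.sum_range_succ] at ih ⊢
        have := h n
        linarith
    intro n
    cases n with
    | zero => simp [hm 0]
    | succ n =>
      refine (h2 n).trans ?_
      rw [Finset.sum_range_succ m]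
      have := hm n
      linarith
  have h3 := h1 n
  have h4 := hes.sum_le_tsum (Finset.range n) (fun i _ => he i)
  linarith

section

variable {E : Type*} [NormedAddCommGroup E] [NormedSpace ℂ E]

/-- Iterated primitives of a linear vector field that are summable at one point of a small ball are
uniformly summable on the ball. -/
theorem exists_ball_forall_summable_of_hasDerivAt {Z : Set ℂ} (hZ : IsOpen Z)
    {A : ℂ → E →L[ℂ] E} (hA : ContinuousOn A Z) {d : ℕ → ℂ → E}
    (hd : ∀ k, DifferentiableOn ℂ (d k) Z)
    (hd' : ∀ k, ∀ z ∈ Z, HasDerivAt (d (k + 1)) (A z (d k z)) z) {a : ℂ} (ha : a ∈ Z) :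
    ∃ r > 0, Metric.ball a r ⊆ Z ∧ ∀ x ∈ Metric.ball a r, (Summable fun k => ‖d k x‖) →
      ∃ m : ℕ → ℝ, Summable m ∧ ∀ k, ∀ w ∈ Metric.ball a r, ‖d k w‖ ≤ m k := by
  have hAa : ContinuousAt A a := hA.continuousAt (hZ.mem_nhds ha)
  have hev : ∀ᶠ w in 𝓝 a, ‖A w‖ < ‖A a‖ + 1 :=
    hAa.norm.eventually (Iio_mem_nhds (lt_add_one _))
  obtain ⟨R, hR, hRs⟩ := Metric.mem_nhds_iff.1 (hev.and (hZ.mem_nhds ha))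
  set M := ‖A a‖ + 1 with hM
  have hMpos : 0 < M := by positivity
  -- Points of the closed ball are at most `2 r` apart and `2 r M ≤ 1/2`, so one integration at
  -- least halves the sup norm, up to the value at `x`.
  set r := min (R / 2) (1 / (4 * M)) with hr
  have hrpos : 0 < r := by positivity
  have hrR : r < R := (min_le_left _ _).trans_lt (by linarith)
  have hrM : 2 * r * M ≤ 1 / 2 := by
    have : r * (4 * M) ≤ 1 := (le_div_iff₀ (by positivity)).1 (min_le_right _ _)
    linarith
  have hsub : Metric.closedBall a r ⊆ Metric.ball a R := Metric.closedBall_subset_ball hrR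
  have hsubZ : Metric.closedBall a r ⊆ Z := fun w hw => (hRs (hsub hw)).2
  refine ⟨r, hrpos, Metric.ball_subset_closedBall.trans hsubZ, fun x hx hsum => ?_⟩
  have hmax : ∀ k, ∃ w ∈ Metric.closedBall a r, IsMaxOn (fun w => ‖d k w‖) (Metric.closedBall a r) w :=
    fun k => (isCompact_closedBall a r).exists_isMaxOn ⟨a, Metric.mem_closedBall_self hrpos.le⟩
      (((hd k).mono hsubZ).continuousOn.norm)
  choose w hw hwmax using hmax
  refine ⟨fun k => ‖d k (w k)‖, ?_, fun k v hv => hwmax k (Metric.ball_subset_closedBall hv)⟩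
  refine summable_of_succ_le_add_half (fun _ => norm_nonneg _) (fun _ => norm_nonneg _) hsum
    fun k => ?_
  have hmv := (convex_closedBall a r).norm_image_sub_le_of_norm_hasDerivWithin_le
    (f := d (k + 1)) (f' := fun z => A z (d k z)) (C := M * ‖d k (w k)‖)
    (fun v hv => (hd' k v (hsubZ hv)).hasDerivWithinAt)
    (fun v hv => ((A v).le_opNorm _).trans
      (mul_le_mul (hRs (hsub hv)).1.le (hwmax k hv) (norm_nonneg _) hMpos.le))
    (Metric.ball_subset_closedBall hx) (hw (k + 1))
  have hdist : ‖w (k + 1) - x‖ ≤ 2 * r := by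
    rw [← dist_eq_norm]
    have h1 := Metric.mem_closedBall.1 (hw (k + 1))
    have h2 := Metric.mem_ball.1 hx
    rw [dist_comm] at h2
    linarith [dist_triangle (w (k + 1)) a x]
  have h1 : ‖d (k + 1) (w (k + 1))‖ ≤ ‖d (k + 1) x‖ + ‖d (k + 1) (w (k + 1)) - d (k + 1) x‖ := by
    have := norm_add_le (d (k + 1) x) (d (k + 1) (w (k + 1)) - d (k + 1) x)
    simpa using this
  have h2 : M * ‖d k (w k)‖ * ‖w (k + 1) - x‖ ≤ ‖d k (w k)‖ / 2 := by
    calc M * ‖d k (w k)‖ * ‖w (k + 1) - x‖ ≤ M * ‖d k (w k)‖ * (2 * r) := by gcongr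
      _ = (2 * r * M) * ‖d k (w k)‖ := by ring
      _ ≤ 1 / 2 * ‖d k (w k)‖ := by gcongr
      _ = _ := by ring
  linarith

/-- Global existence for linear holomorphic systems on a connected open set on which holomorphic
functions have primitives. -/
theorem exists_hasDerivAt_linear [CompleteSpace E] {Z : Set ℂ} (hZ : IsOpen Z)
    (hZc : IsPreconnected Z)
    (hprim : ∀ f : ℂ → E, DifferentiableOn ℂ f Z → Complex.IsExactOn f Z)
    {A : ℂ → E →L[ℂ] E} (hA : DifferentiableOn ℂ A Z) {b : ℂ → E} (hb : DifferentiableOn ℂ b Z)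
    {z₀ : ℂ} (hz₀ : z₀ ∈ Z) (y₀ : E) :
    ∃ Y : ℂ → E, Y z₀ = y₀ ∧ ∀ z ∈ Z, HasDerivAt Y (A z (Y z) + b z) z := by
  have hstep : ∀ f : {f : ℂ → E // DifferentiableOn ℂ f Z},
      ∃ g : {f : ℂ → E // DifferentiableOn ℂ f Z},
        g.1 z₀ = 0 ∧ ∀ z ∈ Z, HasDerivAt g.1 (A z (f.1 z)) z := by
    intro f
    obtain ⟨g, hg0, hg⟩ := (hprim _ (hA.clm_apply f.2)).with_val_at z₀ 0
    exact ⟨⟨g, fun z hz => (hg z hz).differentiableAt.differentiableWithinAt⟩, hg0, hg⟩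
  choose P hP0 hP using hstep
  -- Picard increments: `d 0` is a primitive of `A y₀ + b` and `d (k + 1)` one of `A (d k)`, all
  -- vanishing at `z₀`; the solution is `y₀ + ∑ d k`.
  obtain ⟨δ, hδ0, hδ⟩ := (hprim _ ((hA.clm_apply (differentiableOn_const y₀)).add hb)).with_val_at
    z₀ 0
  let D : ℕ → {f : ℂ → E // DifferentiableOn ℂ f Z} := fun k =>
    P^[k] ⟨δ, fun z hz => (hδ z hz).differentiableAt.differentiableWithinAt⟩
  have hDs : ∀ k, D (k + 1) = P (D k) := fun k => Function.iterate_succ_apply' P k _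
  set d : ℕ → ℂ → E := fun k => (D k).1 with hd
  have hdiff : ∀ k, DifferentiableOn ℂ (d k) Z := fun k => (D k).2
  have hd' : ∀ k, ∀ z ∈ Z, HasDerivAt (d (k + 1)) (A z (d k z)) z := by
    intro k z hz
    have := hP (D k) z hz
    rw [← hDs] at this
    exact this
  have hd0 : ∀ k, d k z₀ = 0 := by
    intro k
    cases k with
    | zero => exact hδ0
    | succ k =>
      have := hP0 (D k)
      rw [← hDs] at this
      exact this
  have hloc := fun a (ha : a ∈ Z) =>
    exists_ball_forall_summable_of_hasDerivAt hZ hA.continuousOn hdiff hd' ha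
  have hpt : ∀ z ∈ Z, Summable fun k => ‖d k z‖ := by
    -- The convergence set is open and closed in `Z`: on a small ball, convergence at one point, not
    -- necessarily the centre, spreads to the whole ball.
    set T := {z | z ∈ Z ∧ Summable fun k => ‖d k z‖} with hT
    have hball : ∀ a ∈ Z, ∃ r > 0, Metric.ball a r ⊆ T ∨ Metric.ball a r ⊆ Tᶜ := by
      intro a ha
      obtain ⟨r, hr, hrZ, hsum⟩ := hloc a ha
      refine ⟨r, hr, ?_⟩
      by_cases hx : ∃ x ∈ Metric.ball a r, x ∈ T
      · obtain ⟨x, hx, hxT⟩ := hx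
        obtain ⟨m, hm, hmd⟩ := hsum x hx hxT.2
        exact Or.inl fun w hw => ⟨hrZ hw, Summable.of_nonneg_of_le (fun _ => norm_nonneg _)
          (fun k => hmd k w hw) hm⟩
      · push Not at hx
        exact Or.inr hx
    have h1 : IsOpen T := by
      rw [Metric.isOpen_iff]
      intro a ha
      obtain ⟨r, hr, h | h⟩ := hball a ha.1
      · exact ⟨r, hr, h⟩
      · exact absurd ha (h (Metric.mem_ball_self hr))
    have h2 : IsOpen (Z \ T) := by
      rw [Metric.isOpen_iff]
      intro a ha
      obtain ⟨ρ, hρ, hρZ⟩ := Metric.isOpen_iff.1 hZ a ha.1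
      obtain ⟨r, hr, h | h⟩ := hball a ha.1
      · exact absurd (h (Metric.mem_ball_self hr)) ha.2
      · refine ⟨min ρ r, lt_min hρ hr, fun w hw => ⟨hρZ (Metric.ball_subset_ball (min_le_left _ _) hw),
          h (Metric.ball_subset_ball (min_le_right _ _) hw)⟩⟩
    have hz₀T : z₀ ∈ T := ⟨hz₀, by simp [hd0]⟩
    have hsub : Z ⊆ T := hZc.subset_left_of_subset_union h1 h2 Set.disjoint_sdiff_right
      (fun z hz => by by_cases h : z ∈ T <;> simp [h, hz]) ⟨z₀, hz₀, hz₀T⟩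
    exact fun z hz => (hsub hz).2
  refine ⟨fun z => y₀ + ∑' k, d k z, by simp [hd0], fun z hz => ?_⟩
  obtain ⟨r, hr, hrZ, hsum⟩ := hloc z hz
  have hzr := Metric.mem_ball_self (x := z) hr
  obtain ⟨m, hm, hmd⟩ := hsum z hzr (hpt z hz)
  have hS : Summable fun k => d k z := (hpt z hz).of_norm
  have hdiffS := Complex.differentiableOn_tsum_of_summable_norm hm
    (fun k => (hdiff k).mono hrZ) Metric.isOpen_ball hmd
  have hderivS := Complex.hasSum_deriv_of_summable_norm hm
    (fun k => (hdiff k).mono hrZ) Metric.isOpen_ball hmd hzr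
  have hderiv0 : ∀ k, deriv (d (k + 1)) z = A z (d k z) := fun k => (hd' k z hz).deriv
  have hval : deriv (fun w => ∑' k, d k w) z = A z y₀ + b z + A z (∑' k, d k z) := by
    rw [← hderivS.tsum_eq, hderivS.summable.tsum_eq_zero_add]
    simp only [hderiv0]
    rw [(A z).map_tsum hS]
    congr 1
    exact (hδ z hz).deriv
  have := ((hdiffS.differentiableAt (Metric.isOpen_ball.mem_nhds hzr)).hasDerivAt).const_add y₀
  rw [hval] at this
  convert! this using 1
  rw [map_add]; abel

end

/-- Global existence for second order linear holomorphic equations on a simply connected open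
set. -/
theorem exists_hasDerivAt_linear_second_order {Z : Set ℂ} (hZ : IsOpen Z)
    (hZsc : IsSimplyConnected Z) {F p : ℂ → ℂ} (hF : DifferentiableOn ℂ F Z)
    (hp : DifferentiableOn ℂ p Z) {z₀ : ℂ} (hz₀ : z₀ ∈ Z) (a b : ℂ) :
    ∃ w w' : ℂ → ℂ, w z₀ = a ∧ w' z₀ = b ∧ ∀ z ∈ Z, HasDerivAt w (w' z) z ∧
      HasDerivAt w' (F z * w z + p z) z := by
  -- Companion form `(w, w')' = (w', F w + p)`.
  let N₁ : ℂ × ℂ →L[ℂ] ℂ × ℂ :=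
    (ContinuousLinearMap.inl ℂ ℂ ℂ).comp (ContinuousLinearMap.snd ℂ ℂ ℂ)
  let N₂ : ℂ × ℂ →L[ℂ] ℂ × ℂ :=
    (ContinuousLinearMap.inr ℂ ℂ ℂ).comp (ContinuousLinearMap.fst ℂ ℂ ℂ)
  obtain ⟨Y, hY0, hY⟩ := exists_hasDerivAt_linear hZ hZsc.isPathConnected.isConnected.isPreconnected
    (fun f hf => hf.exists_primitive_of_isSimplyConnected hZ hZsc)
    (A := fun z => N₁ + F z • N₂) ((differentiableOn_const N₁).add (hF.smul_const N₂))
    (b := fun z => (0, p z)) ((differentiableOn_const 0).prodMk hp) hz₀ (a, b)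
  refine ⟨fun z => (Y z).1, fun z => (Y z).2, by simp [hY0], by simp [hY0], fun z hz => ?_⟩
  have h := hY z hz
  have h1 := h.hasFDerivAt.fst.hasDerivAt
  have h2 := h.hasFDerivAt.snd.hasDerivAt
  refine ⟨?_, ?_⟩
  · simpa [N₁, N₂] using h1
  · simpa [N₁, N₂] using h2

/-! ### Uniqueness on the line off a discrete set -/

open MeasureTheory Set in
/-- A Grönwall uniqueness lemma in which the differential inequality is allowed to fail at a
discrete set of points. -/
theorem Continuous.eq_zero_of_norm_deriv_le_off_discrete {E : Type*} [NormedAddCommGroup E]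
    [NormedSpace ℝ E] {v : ℝ → E} (hv : Continuous v)
    (h : ∀ t, ∃ C, ∀ᶠ s in 𝓝[≠] t, DifferentiableAt ℝ v s ∧ ‖deriv v s‖ ≤ C * ‖v s‖)
    {t₀ : ℝ} (h0 : v t₀ = 0) (t : ℝ) : v t = 0 := by
  have hclosed : IsClosed {t | v t = 0} := isClosed_eq hv continuous_const
  have hopen : IsOpen {t | v t = 0} := by
    rw [Metric.isOpen_iff]
    intro t (ht : v t = 0)
    obtain ⟨C₀, hC₀⟩ := h t
    set C := max C₀ 0
    have hC : 0 ≤ C := le_max_right _ _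
    rw [eventually_nhdsWithin_iff, Metric.eventually_nhds_iff] at hC₀
    obtain ⟨δ, hδ, hb⟩ := hC₀
    -- Chosen so that `C ρ ≤ 1/2`: the maximum of `‖v‖` near `t` is then at most half of itself.
    set ρ := min (δ / 2) (1 / (2 * (C + 1))) with hρ
    have hρ0 : 0 < ρ := by positivity
    have hρδ : ρ < δ := (min_le_left _ _).trans_lt (by linarith)
    have hρC : C * ρ ≤ 1 / 2 := by
      have h1 : ρ * (2 * (C + 1)) ≤ 1 := (le_div_iff₀ (by positivity)).1 (min_le_right _ _)
      nlinarith
    obtain ⟨m, hm, hmax⟩ := (isCompact_Icc (a := t - ρ) (b := t + ρ)).exists_isMaxOn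
      ⟨t, by constructor <;> linarith⟩ hv.norm.continuousOn
    -- Here `t` may be an end point but not an interior point, since nothing is known about the
    -- derivative at `t`.
    have hkey : ∀ a b, a ≤ b → Icc a b ⊆ Icc (t - ρ) (t + ρ) → t ∉ Ioo a b →
        ‖v b - v a‖ ≤ C * ‖v m‖ * (b - a) := by
      intro a b hab hsub ht
      have hd : ∀ s ∈ Ioo a b, DifferentiableAt ℝ v s ∧ ‖deriv v s‖ ≤ C₀ * ‖v s‖ := by
        intro s hs
        have hs' := hsub (Ioo_subset_Icc_self hs)
        refine hb (y := s) ?_ (by rintro rfl; exact ht hs)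
        rw [Real.dist_eq, abs_lt]
        constructor <;> linarith [hs'.1, hs'.2]
      have := norm_sub_le_integral_of_norm_deriv_le_of_le (B := fun _ => C * ‖v m‖) hab
        hv.continuousOn (fun s hs => (hd s hs).1.differentiableWithinAt)
        (Eventually.of_forall fun s hs => (hd s hs).2.trans (by
          have := hmax (hsub (Ioo_subset_Icc_self hs))
          gcongr
          exacts [le_max_left _ _, this])) (by simp)
      simpa [mul_comm, mul_left_comm] using this
    have hm0 : ‖v m‖ ≤ C * ‖v m‖ * ρ := by
      rcases le_total m t with hmt | hmt
      · have := hkey m t hmt (Icc_subset_Icc hm.1 (by linarith)) (by simp)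
        rw [ht, zero_sub, norm_neg] at this
        refine this.trans ?_
        gcongr
        linarith [hm.1]
      · have := hkey t m hmt (Icc_subset_Icc (by linarith) hm.2) (by simp)
        rw [ht, sub_zero] at this
        refine this.trans ?_
        gcongr
        linarith [hm.2]
    have hmz : ‖v m‖ ≤ 0 := by nlinarith [norm_nonneg (v m)]
    refine ⟨ρ, hρ0, fun s hs => ?_⟩
    rw [Metric.mem_ball, Real.dist_eq, abs_lt] at hs
    have : ‖v s‖ ≤ ‖v m‖ := hmax (show s ∈ Icc (t - ρ) (t + ρ) by constructor <;> linarith [hs.1, hs.2])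
    exact norm_le_zero_iff.1 (this.trans hmz)
  have := IsClopen.eq_univ ⟨hclosed, hopen⟩ ⟨t₀, h0⟩
  exact (this ▸ mem_univ t : t ∈ {t | v t = 0})

theorem Finset.eventually_notMem_nhdsNE {X : Type*} [TopologicalSpace X] [T1Space X] (S : Finset X)
    (t : X) : ∀ᶠ s in 𝓝[≠] t, s ∉ S := by
  have h : ((S : Set X) \ {t})ᶜ ∈ 𝓝 t :=
    (S.finite_toSet.subset Set.sdiff_subset).isClosed.isOpen_compl.mem_nhds (by simp)
  rw [eventually_nhdsWithin_iff]
  filter_upwards [h] with s hs hst hsS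
  exact hs ⟨hsS, hst⟩

theorem Continuous.eq_of_hasDerivAt_zero_off_finset {E : Type*} [NormedAddCommGroup E]
    [NormedSpace ℝ E] {v : ℝ → E} (hv : Continuous v) (S : Finset ℝ)
    (h : ∀ t ∉ S, HasDerivAt v 0 t) (t t₀ : ℝ) : v t = v t₀ := by
  have := (hv.sub continuous_const).eq_zero_of_norm_deriv_le_off_discrete
    (v := fun t => v t - v t₀) (t₀ := t₀) (fun t => ⟨0, by
      filter_upwards [S.eventually_notMem_nhdsNE t] with s hs
      have := (h s hs).sub_const (v t₀)
      exact ⟨this.differentiableAt, by simp [this.deriv]⟩⟩) (by simp) t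
  exact sub_eq_zero.1 this

/-! ### Convolution integrals along a path -/

/-- A continuous path that is continuously differentiable off a finite set, with locally bounded
derivative. -/
structure IsPiecewiseC1 (x : ℝ → ℂ) (S : Finset ℝ) : Prop where
  continuous : Continuous x
  hasDerivAt : ∀ t ∉ S, HasDerivAt x (deriv x t) t
  continuousAt_deriv : ∀ t ∉ S, ContinuousAt (deriv x) t
  bounded_deriv : ∀ t, ∃ C, ∀ᶠ s in 𝓝[≠] t, ‖deriv x s‖ ≤ C

/-- The convolution `∫ e^{a (x(τ) - x(s))} φ(s) dx(s)` over the part of the path after `τ`. -/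
noncomputable def futureIntegral (x : ℝ → ℂ) (a : ℂ) (φ : ℝ → ℂ) (τ : ℝ) : ℂ :=
  ∫ s in Set.Ioi τ, Complex.exp (a * (x τ - x s)) * (φ s * deriv x s)

/-- The convolution `∫ e^{a (x(s) - x(τ))} φ(s) dx(s)` over the part of the path before `τ`. -/
noncomputable def pastIntegral (x : ℝ → ℂ) (a : ℂ) (φ : ℝ → ℂ) (τ : ℝ) : ℂ :=
  ∫ s in Set.Iic τ, Complex.exp (a * (x s - x τ)) * (φ s * deriv x s)

section

open MeasureTheory Set

variable {x : ℝ → ℂ} {S : Finset ℝ} {a : ℂ} {φ : ℝ → ℂ}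

/-- Monotonicity of `Re (a x)` tames the kernels of both convolutions, so no decay beyond
integrability of `φ dx` is needed. -/
theorem norm_exp_mul_sub_le_one (hmono : Monotone fun t => (a * x t).re) {s t : ℝ} (h : s ≤ t) :
    ‖Complex.exp (a * (x s - x t))‖ ≤ 1 := by
  rw [Complex.norm_exp, Real.exp_le_one_iff, mul_sub, Complex.sub_re]
  exact sub_nonpos.2 (hmono h)

theorem integrableOn_futureIntegral (hx : Continuous x) (hmono : Monotone fun t => (a * x t).re)
    (hint : Integrable fun s => φ s * deriv x s) (τ : ℝ) :
    IntegrableOn (fun s => Complex.exp (a * (x τ - x s)) * (φ s * deriv x s)) (Ioi τ) := by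
  refine hint.integrableOn.bdd_mul (c := 1) (Continuous.aestronglyMeasurable (by fun_prop)) ?_
  filter_upwards [ae_restrict_mem measurableSet_Ioi] with s hs
  exact norm_exp_mul_sub_le_one hmono (le_of_lt hs)

theorem integrableOn_pastIntegral (hx : Continuous x) (hmono : Monotone fun t => (a * x t).re)
    (hint : Integrable fun s => φ s * deriv x s) (τ : ℝ) :
    IntegrableOn (fun s => Complex.exp (a * (x s - x τ)) * (φ s * deriv x s)) (Iic τ) := by
  refine hint.integrableOn.bdd_mul (c := 1) (Continuous.aestronglyMeasurable (by fun_prop)) ?_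
  filter_upwards [ae_restrict_mem measurableSet_Iic] with s hs
  exact norm_exp_mul_sub_le_one hmono hs

theorem norm_futureIntegral_le (hmono : Monotone fun t => (a * x t).re)
    (hint : Integrable fun s => φ s * deriv x s) (τ : ℝ) :
    ‖futureIntegral x a φ τ‖ ≤ ∫ s in Ioi τ, ‖φ s * deriv x s‖ := by
  refine norm_integral_le_of_norm_le hint.norm.integrableOn ?_
  filter_upwards [ae_restrict_mem measurableSet_Ioi] with s hs
  rw [norm_mul]
  exact mul_le_of_le_one_left (norm_nonneg _) (norm_exp_mul_sub_le_one hmono (le_of_lt hs))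

theorem norm_pastIntegral_le (hmono : Monotone fun t => (a * x t).re)
    (hint : Integrable fun s => φ s * deriv x s) (τ : ℝ) :
    ‖pastIntegral x a φ τ‖ ≤ ∫ s in Iic τ, ‖φ s * deriv x s‖ := by
  refine norm_integral_le_of_norm_le hint.norm.integrableOn ?_
  filter_upwards [ae_restrict_mem measurableSet_Iic] with s hs
  rw [norm_mul]
  exact mul_le_of_le_one_left (norm_nonneg _) (norm_exp_mul_sub_le_one hmono hs)

/-- Splitting the exponential leaves `τ` only in an explicit factor and in an end point, so that the
fundamental theorem of calculus applies. -/
theorem futureIntegral_eq_exp_mul (τ : ℝ) : futureIntegral x a φ τ =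
    Complex.exp (a * x τ) * ∫ s in Ioi τ, Complex.exp (-(a * x s)) * (φ s * deriv x s) := by
  rw [futureIntegral, ← integral_const_mul]
  congr 1; ext s
  rw [← mul_assoc (Complex.exp (a * x τ)), ← Complex.exp_add]
  ring_nf

theorem pastIntegral_eq_exp_mul (τ : ℝ) : pastIntegral x a φ τ =
    Complex.exp (-(a * x τ)) * ∫ s in Iic τ, Complex.exp (a * x s) * (φ s * deriv x s) := by
  rw [pastIntegral, ← integral_const_mul]
  congr 1; ext s
  rw [← mul_assoc (Complex.exp (-(a * x τ))), ← Complex.exp_add]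
  ring_nf

theorem IsPiecewiseC1.continuousAt_exp_mul (hx : IsPiecewiseC1 x S) (hφ : Continuous φ) (b : ℂ)
    {t : ℝ} (ht : t ∉ S) :
    ContinuousAt (fun s => Complex.exp (b * x s) * (φ s * deriv x s)) t :=
  ((Complex.continuous_exp.comp (continuous_const.mul hx.continuous)).continuousAt).mul
    (hφ.continuousAt.mul (hx.continuousAt_deriv t ht))

theorem intervalIntegrable_exp_mul (hx : Continuous x)
    (hint : Integrable fun s => φ s * deriv x s) (b : ℂ) (s t : ℝ) :
    IntervalIntegrable (fun s => Complex.exp (b * x s) * (φ s * deriv x s)) volume s t :=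
  hint.intervalIntegrable.continuousOn_mul (Continuous.continuousOn (by fun_prop))

theorem IsPiecewiseC1.hasDerivAt_integral_exp_mul (hx : IsPiecewiseC1 x S) (hφ : Continuous φ)
    (hint : Integrable fun s => φ s * deriv x s) (b : ℂ) (t₀ : ℝ) {t : ℝ} (ht : t ∉ S) :
    HasDerivAt (fun t => ∫ s in t₀..t, Complex.exp (b * x s) * (φ s * deriv x s))
      (Complex.exp (b * x t) * (φ t * deriv x t)) t := by
  refine intervalIntegral.integral_hasDerivAt_right
    (intervalIntegrable_exp_mul hx.continuous hint b t₀ t) ?_ (hx.continuousAt_exp_mul hφ b ht)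
  have h1 : AEStronglyMeasurable (fun s => Complex.exp (b * x s)) volume :=
    Continuous.aestronglyMeasurable (by have := hx.continuous; fun_prop)
  exact (h1.mul hint.aestronglyMeasurable).stronglyMeasurableAtFilter

theorem integral_Ioi_exp_eq (hx : Continuous x) (hmono : Monotone fun t => (a * x t).re)
    (hint : Integrable fun s => φ s * deriv x s) (t : ℝ) :
    ∫ s in Ioi t, Complex.exp (-(a * x s)) * (φ s * deriv x s)
      = (∫ s in Ioi (0 : ℝ), Complex.exp (-(a * x s)) * (φ s * deriv x s))
        - ∫ s in (0 : ℝ)..t, Complex.exp (-a * x s) * (φ s * deriv x s) := by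
  have hi : ∀ t, IntegrableOn (fun s => Complex.exp (-(a * x s)) * (φ s * deriv x s)) (Ioi t) := by
    intro t
    refine ((integrableOn_futureIntegral hx hmono hint t).const_mul
      (Complex.exp (-(a * x t)))).congr (Eventually.of_forall fun s => ?_)
    simp only
    rw [← mul_assoc, ← Complex.exp_add]
    ring_nf
  simp only [neg_mul]
  rw [← intervalIntegral.integral_interval_add_Ioi (hi 0) (hi t)]
  ring

theorem integral_Iic_exp_eq (hx : Continuous x) (hmono : Monotone fun t => (a * x t).re)
    (hint : Integrable fun s => φ s * deriv x s) (t : ℝ) :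
    ∫ s in Iic t, Complex.exp (a * x s) * (φ s * deriv x s)
      = (∫ s in Iic (0 : ℝ), Complex.exp (a * x s) * (φ s * deriv x s))
        + ∫ s in (0 : ℝ)..t, Complex.exp (a * x s) * (φ s * deriv x s) := by
  have hi : ∀ t, IntegrableOn (fun s => Complex.exp (a * x s) * (φ s * deriv x s)) (Iic t) := by
    intro t
    refine ((integrableOn_pastIntegral hx hmono hint t).const_mul
      (Complex.exp (a * x t))).congr (Eventually.of_forall fun s => ?_)
    simp only
    rw [← mul_assoc, ← Complex.exp_add]
    ring_nf
  rw [← intervalIntegral.integral_Iic_sub_Iic (hi 0) (hi t)]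
  ring

theorem continuous_futureIntegral (hx : Continuous x) (hmono : Monotone fun t => (a * x t).re)
    (hint : Integrable fun s => φ s * deriv x s) : Continuous (futureIntegral x a φ) := by
  have h := intervalIntegral.continuous_primitive (intervalIntegrable_exp_mul hx hint (-a)) 0
  have : futureIntegral x a φ = fun t => Complex.exp (a * x t) *
      ((∫ s in Ioi (0 : ℝ), Complex.exp (-(a * x s)) * (φ s * deriv x s))
        - ∫ s in (0 : ℝ)..t, Complex.exp (-a * x s) * (φ s * deriv x s)) := by
    ext t
    rw [futureIntegral_eq_exp_mul, integral_Ioi_exp_eq hx hmono hint]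
  rw [this]
  exact (Complex.continuous_exp.comp (continuous_const.mul hx)).mul (continuous_const.sub h)

theorem continuous_pastIntegral (hx : Continuous x) (hmono : Monotone fun t => (a * x t).re)
    (hint : Integrable fun s => φ s * deriv x s) : Continuous (pastIntegral x a φ) := by
  have h := intervalIntegral.continuous_primitive (intervalIntegrable_exp_mul hx hint a) 0
  have : pastIntegral x a φ = fun t => Complex.exp (-(a * x t)) *
      ((∫ s in Iic (0 : ℝ), Complex.exp (a * x s) * (φ s * deriv x s))
        + ∫ s in (0 : ℝ)..t, Complex.exp (a * x s) * (φ s * deriv x s)) := by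
    ext t
    rw [pastIntegral_eq_exp_mul, integral_Iic_exp_eq hx hmono hint]
  rw [this]
  exact (Complex.continuous_exp.comp (continuous_const.mul hx).neg).mul (continuous_const.add h)

theorem IsPiecewiseC1.hasDerivAt_futureIntegral (hx : IsPiecewiseC1 x S)
    (hmono : Monotone fun t => (a * x t).re) (hφ : Continuous φ)
    (hint : Integrable fun s => φ s * deriv x s) {t : ℝ} (ht : t ∉ S) :
    HasDerivAt (futureIntegral x a φ) ((a * futureIntegral x a φ t - φ t) * deriv x t) t := by
  have h1 := (hx.hasDerivAt_integral_exp_mul hφ hint (-a) 0 ht).const_sub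
    (∫ s in Ioi (0 : ℝ), Complex.exp (-(a * x s)) * (φ s * deriv x s))
  have h2 := ((hx.hasDerivAt t ht).const_mul a).cexp.mul h1
  have hfun : futureIntegral x a φ = fun t => Complex.exp (a * x t) *
      ((∫ s in Ioi (0 : ℝ), Complex.exp (-(a * x s)) * (φ s * deriv x s))
        - ∫ s in (0 : ℝ)..t, Complex.exp (-a * x s) * (φ s * deriv x s)) := by
    ext t
    rw [futureIntegral_eq_exp_mul, integral_Ioi_exp_eq hx.continuous hmono hint]
  rw [hfun]
  refine h2.congr_deriv ?_
  have h3 : Complex.exp (a * x t) * Complex.exp (-a * x t) = 1 := by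
    rw [← Complex.exp_add]; simp
  linear_combination (-(φ t * deriv x t)) * h3

theorem IsPiecewiseC1.hasDerivAt_pastIntegral (hx : IsPiecewiseC1 x S)
    (hmono : Monotone fun t => (a * x t).re) (hφ : Continuous φ)
    (hint : Integrable fun s => φ s * deriv x s) {t : ℝ} (ht : t ∉ S) :
    HasDerivAt (pastIntegral x a φ) ((-(a * pastIntegral x a φ t) + φ t) * deriv x t) t := by
  have h1 := (hx.hasDerivAt_integral_exp_mul hφ hint a 0 ht).const_add
    (∫ s in Iic (0 : ℝ), Complex.exp (a * x s) * (φ s * deriv x s))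
  have h2 := ((hx.hasDerivAt t ht).const_mul a).neg.cexp.mul h1
  have hfun : pastIntegral x a φ = fun t => Complex.exp (-(a * x t)) *
      ((∫ s in Iic (0 : ℝ), Complex.exp (a * x s) * (φ s * deriv x s))
        + ∫ s in (0 : ℝ)..t, Complex.exp (a * x s) * (φ s * deriv x s)) := by
    ext t
    rw [pastIntegral_eq_exp_mul, integral_Iic_exp_eq hx.continuous hmono hint]
  rw [hfun]
  refine h2.congr_deriv ?_
  have h3 : Complex.exp (-(a * x t)) * Complex.exp (a * x t) = 1 := by
    rw [← Complex.exp_add]; simp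
  simp only [Pi.neg_apply]
  linear_combination (φ t * deriv x t) * h3

/-- The two half-lines partition the path, so both terms together cost one total integral. This
gives the factor `1 / (2|u|)` rather than `1 / |u|` in the estimates. -/
theorem norm_futureIntegral_add_norm_pastIntegral_le {b : ℂ}
    (hmono : Monotone fun t => (a * x t).re) (hmono' : Monotone fun t => (b * x t).re)
    (hint : Integrable fun s => φ s * deriv x s) (τ : ℝ) :
    ‖futureIntegral x a φ τ‖ + ‖pastIntegral x b φ τ‖ ≤ ∫ s, ‖φ s * deriv x s‖ := by
  rw [← intervalIntegral.integral_Iic_add_Ioi (b := τ) hint.norm.integrableOn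
    hint.norm.integrableOn, add_comm]
  exact add_le_add (norm_pastIntegral_le hmono' hint τ) (norm_futureIntegral_le hmono hint τ)

theorem futureIntegral_sub {φ₁ φ₂ : ℝ → ℂ} (hx : Continuous x)
    (hmono : Monotone fun t => (a * x t).re) (h₁ : Integrable fun s => φ₁ s * deriv x s)
    (h₂ : Integrable fun s => φ₂ s * deriv x s) (τ : ℝ) :
    futureIntegral x a (fun s => φ₁ s - φ₂ s) τ
      = futureIntegral x a φ₁ τ - futureIntegral x a φ₂ τ := by
  rw [futureIntegral, futureIntegral, futureIntegral, ← integral_sub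
    (integrableOn_futureIntegral hx hmono h₁ τ) (integrableOn_futureIntegral hx hmono h₂ τ)]
  congr 1; ext s; ring

theorem pastIntegral_sub {φ₁ φ₂ : ℝ → ℂ} (hx : Continuous x)
    (hmono : Monotone fun t => (a * x t).re) (h₁ : Integrable fun s => φ₁ s * deriv x s)
    (h₂ : Integrable fun s => φ₂ s * deriv x s) (τ : ℝ) :
    pastIntegral x a (fun s => φ₁ s - φ₂ s) τ
      = pastIntegral x a φ₁ τ - pastIntegral x a φ₂ τ := by
  rw [pastIntegral, pastIntegral, pastIntegral, ← integral_sub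
    (integrableOn_pastIntegral hx hmono h₁ τ) (integrableOn_pastIntegral hx hmono h₂ τ)]
  congr 1; ext s; ring

end

/-! ### The system on a path: existence, bound and uniqueness -/

/-- The first order system on a path that is satisfied by `h = e^{-cx} ε` and `k = e^{-cx} dε/dx`
when `ε'' = (u² + Ψ) ε - e^{cx} H`. -/
structure IsPathSolution (x : ℝ → ℂ) (S : Finset ℝ) (u c : ℂ) (Ψ H h k : ℝ → ℂ) : Prop where
  continuous_left : Continuous h
  continuous_right : Continuous k
  hasDerivAt_left : ∀ t ∉ S, HasDerivAt h ((k t - c * h t) * deriv x t) t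
  hasDerivAt_right : ∀ t ∉ S,
    HasDerivAt k (((u ^ 2 + Ψ t) * h t - c * k t - H t) * deriv x t) t

/-- The integral operator of the variation of parameters formula on a path. -/
noncomputable def pathKernel (x : ℝ → ℂ) (u c : ℂ) (Ψ h : ℝ → ℂ) (τ : ℝ) : ℂ :=
  -(1 / (2 * u)) * (futureIntegral x (u - c) (fun s => Ψ s * h s) τ
    + pastIntegral x (u + c) (fun s => Ψ s * h s) τ)

section

open MeasureTheory Set

variable {x : ℝ → ℂ} {S : Finset ℝ} {u c : ℂ} {Ψ H h k h₁ h₂ k₁ k₂ H₁ H₂ : ℝ → ℂ}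

theorem IsPathSolution.sub (s₁ : IsPathSolution x S u c Ψ H₁ h₁ k₁)
    (s₂ : IsPathSolution x S u c Ψ H₂ h₂ k₂) :
    IsPathSolution x S u c Ψ (fun t => H₁ t - H₂ t) (fun t => h₁ t - h₂ t)
      (fun t => k₁ t - k₂ t) where
  continuous_left := s₁.continuous_left.sub s₂.continuous_left
  continuous_right := s₁.continuous_right.sub s₂.continuous_right
  hasDerivAt_left t ht := ((s₁.hasDerivAt_left t ht).sub (s₂.hasDerivAt_left t ht)).congr_deriv
    (by ring)
  hasDerivAt_right t ht := ((s₁.hasDerivAt_right t ht).sub (s₂.hasDerivAt_right t ht)).congr_deriv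
    (by ring)

/-- A solution of the homogeneous system with zero data at a point vanishes. -/
theorem IsPathSolution.eq_zero_of_initial (hx : IsPiecewiseC1 x S) (hΨ : Continuous Ψ)
    (s : IsPathSolution x S u c Ψ (fun _ => 0) h k) {t₀ : ℝ} (hh : h t₀ = 0) (hk : k t₀ = 0)
    (t : ℝ) : h t = 0 := by
  have := (s.continuous_left.prodMk s.continuous_right).eq_zero_of_norm_deriv_le_off_discrete
    (t₀ := t₀) (fun t => ?_) (by simp [hh, hk]) t
  · exact congrArg Prod.fst this
  obtain ⟨C, hC⟩ := hx.bounded_deriv t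
  -- Near `t`, `M` bounds the coefficient matrix in the sup norm and `C` bounds the speed of the
  -- path.
  set M := max (1 + ‖c‖) (‖u‖ ^ 2 + (‖Ψ t‖ + 1) + ‖c‖)
  refine ⟨M * C, ?_⟩
  have hΨt : ∀ᶠ s in 𝓝[≠] t, ‖Ψ s‖ < ‖Ψ t‖ + 1 :=
    nhdsWithin_le_nhds (hΨ.norm.continuousAt.eventually (Iio_mem_nhds (lt_add_one _)))
  filter_upwards [hC, hΨt, S.eventually_notMem_nhdsNE t] with r hr hΨr hrS
  have hd := (s.hasDerivAt_left r hrS).prodMk (s.hasDerivAt_right r hrS)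
  refine ⟨hd.differentiableAt, ?_⟩
  rw [hd.deriv]
  have e1 : ‖h r‖ ≤ ‖(h r, k r)‖ := norm_fst_le (h r, k r)
  have e2 : ‖k r‖ ≤ ‖(h r, k r)‖ := norm_snd_le (h r, k r)
  have hM : 0 ≤ M := le_trans (by positivity) (le_max_left _ _)
  have b1 : ‖k r - c * h r‖ ≤ M * ‖(h r, k r)‖ := by
    calc ‖k r - c * h r‖ ≤ ‖k r‖ + ‖c‖ * ‖h r‖ := by
          rw [← norm_mul]; exact norm_sub_le _ _
      _ ≤ ‖(h r, k r)‖ + ‖c‖ * ‖(h r, k r)‖ := by gcongr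
      _ = (1 + ‖c‖) * ‖(h r, k r)‖ := by ring
      _ ≤ _ := by gcongr; exact le_max_left _ _
  have b2 : ‖(u ^ 2 + Ψ r) * h r - c * k r - 0‖ ≤ M * ‖(h r, k r)‖ := by
    rw [sub_zero]
    calc ‖(u ^ 2 + Ψ r) * h r - c * k r‖ ≤ ‖(u ^ 2 + Ψ r) * h r‖ + ‖c * k r‖ := norm_sub_le _ _
      _ ≤ (‖u‖ ^ 2 + ‖Ψ r‖) * ‖h r‖ + ‖c‖ * ‖k r‖ := by
          rw [norm_mul, norm_mul]
          gcongr
          exact (norm_add_le _ _).trans (by rw [norm_pow])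
      _ ≤ (‖u‖ ^ 2 + (‖Ψ t‖ + 1)) * ‖(h r, k r)‖ + ‖c‖ * ‖(h r, k r)‖ := by gcongr
      _ = (‖u‖ ^ 2 + (‖Ψ t‖ + 1) + ‖c‖) * ‖(h r, k r)‖ := by ring
      _ ≤ _ := by gcongr; exact le_max_right _ _
  rw [Prod.norm_mk, norm_mul, norm_mul]
  refine max_le ?_ ?_
  · calc _ ≤ (M * ‖(h r, k r)‖) * C := by gcongr
      _ = _ := by ring
  · calc _ ≤ (M * ‖(h r, k r)‖) * C := by gcongr
      _ = _ := by ring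

theorem integrable_mul_mul_deriv (hh : Continuous h) {C : ℝ} (hC : ∀ t, ‖h t‖ ≤ C)
    (hint : Integrable fun s => Ψ s * deriv x s) :
    Integrable fun s => Ψ s * h s * deriv x s := by
  refine (hint.bdd_mul (c := C) hh.aestronglyMeasurable (Eventually.of_forall hC)).congr
    (Eventually.of_forall fun s => ?_)
  simp only
  ring

theorem norm_pathKernel_le (hm : Monotone fun t => ((u - c) * x t).re)
    (hp : Monotone fun t => ((u + c) * x t).re) (hh : Continuous h) {C : ℝ}
    (hC : ∀ t, ‖h t‖ ≤ C) (hint : Integrable fun s => Ψ s * deriv x s) (τ : ℝ) :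
    ‖pathKernel x u c Ψ h τ‖ ≤ 1 / (2 * ‖u‖) * (∫ s, ‖Ψ s * deriv x s‖) * C := by
  have hi := integrable_mul_mul_deriv hh hC hint
  have h1 := norm_futureIntegral_add_norm_pastIntegral_le hm hp hi τ
  have h2 : ∫ s, ‖Ψ s * h s * deriv x s‖ ≤ C * ∫ s, ‖Ψ s * deriv x s‖ := by
    rw [← integral_const_mul]
    refine integral_mono hi.norm (hint.norm.const_mul C) fun s => ?_
    calc ‖Ψ s * h s * deriv x s‖ = ‖h s‖ * ‖Ψ s * deriv x s‖ := by
          rw [← norm_mul]; ring_nf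
      _ ≤ C * ‖Ψ s * deriv x s‖ := by gcongr; exact hC s
  rw [pathKernel, norm_mul, norm_neg, norm_div, norm_mul, norm_one, Complex.norm_two, mul_assoc]
  gcongr
  refine (norm_add_le _ _).trans (h1.trans (h2.trans_eq (mul_comm _ _)))

theorem continuous_pathKernel (hx : Continuous x) (hm : Monotone fun t => ((u - c) * x t).re)
    (hp : Monotone fun t => ((u + c) * x t).re)
    (hint : Integrable fun s => Ψ s * h s * deriv x s) : Continuous (pathKernel x u c Ψ h) :=
  continuous_const.mul ((continuous_futureIntegral hx hm hint).add
    (continuous_pastIntegral hx hp hint))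

theorem pathKernel_sub (hx : Continuous x) (hm : Monotone fun t => ((u - c) * x t).re)
    (hp : Monotone fun t => ((u + c) * x t).re)
    (hi₁ : Integrable fun s => Ψ s * h₁ s * deriv x s)
    (hi₂ : Integrable fun s => Ψ s * h₂ s * deriv x s) (τ : ℝ) :
    pathKernel x u c Ψ (fun s => h₁ s - h₂ s) τ
      = pathKernel x u c Ψ h₁ τ - pathKernel x u c Ψ h₂ τ := by
  simp only [pathKernel, mul_sub]
  rw [futureIntegral_sub hx hm hi₁ hi₂, pastIntegral_sub hx hp hi₁ hi₂]
  ring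

/-- The image of `h` under the integral operator solves the system with right-hand side `-Ψ h`
and without the term `Ψ`. -/
theorem IsPiecewiseC1.exists_isPathSolution_pathKernel (hx : IsPiecewiseC1 x S) (hu : u ≠ 0)
    (hm : Monotone fun t => ((u - c) * x t).re) (hp : Monotone fun t => ((u + c) * x t).re)
    (hΨ : Continuous Ψ) (hh : Continuous h)
    (hint : Integrable fun s => Ψ s * h s * deriv x s) :
    ∃ k, IsPathSolution x S u c (fun _ => 0) (fun t => -(Ψ t * h t)) (pathKernel x u c Ψ h) k := by
  -- This is `dh/dx + c h` for `h = pathKernel`; the terms without integral cancel, having opposite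
  -- signs in the two derivatives.
  refine ⟨fun τ => -(1 / 2) * (futureIntegral x (u - c) (fun s => Ψ s * h s) τ
    - pastIntegral x (u + c) (fun s => Ψ s * h s) τ),
    continuous_pathKernel hx.continuous hm hp hint,
    continuous_const.mul ((continuous_futureIntegral hx.continuous hm hint).sub
      (continuous_pastIntegral hx.continuous hp hint)), fun t ht => ?_, fun t ht => ?_⟩
  · have hF := hx.hasDerivAt_futureIntegral (φ := fun s => Ψ s * h s) hm (hΨ.mul hh) hint ht
    have hP := hx.hasDerivAt_pastIntegral (φ := fun s => Ψ s * h s) hp (hΨ.mul hh) hint ht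
    refine ((hF.add hP).const_mul (-(1 / (2 * u)))).congr_deriv ?_
    rw [pathKernel]
    field_simp
    ring
  · have hF := hx.hasDerivAt_futureIntegral (φ := fun s => Ψ s * h s) hm (hΨ.mul hh) hint ht
    have hP := hx.hasDerivAt_pastIntegral (φ := fun s => Ψ s * h s) hp (hΨ.mul hh) hint ht
    refine ((hF.sub hP).const_mul (-(1 / 2))).congr_deriv ?_
    rw [pathKernel]
    field_simp
    ring

/-- A particular solution of the system without the term `Ψ`, with its bound. -/
theorem IsPiecewiseC1.exists_isPathSolution_zero (hx : IsPiecewiseC1 x S) {c : ℝ} (hc : |c| < ‖u‖)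
    (hm : Monotone fun t => ((u - c) * x t).re) (hp : Monotone fun t => ((u + c) * x t).re)
    (hH : Continuous H) (hH₁ : Continuous H₁) (hd : ∀ t ∉ S, HasDerivAt H (H₁ t * deriv x t) t)
    (hint : Integrable fun s => H₁ s * deriv x s) :
    ∃ h k, IsPathSolution x S u c (fun _ => 0) H h k ∧ ∀ t, ‖h t‖ ≤
      ‖H t / (u ^ 2 - c ^ 2)‖ + 1 / (2 * ‖u‖ * (‖u‖ - |c|)) * ∫ s, ‖H₁ s * deriv x s‖ := by
  have hu0 : 0 < ‖u‖ := (abs_nonneg c).trans_lt hc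
  have hu : u ≠ 0 := norm_pos_iff.1 hu0
  have hpos : 0 < ‖u‖ - |c| := sub_pos.2 hc
  have hcn : ‖(c : ℂ)‖ = |c| := by simp
  have nm : ‖u‖ - |c| ≤ ‖u - c‖ := hcn ▸ norm_sub_norm_le u c
  have np : ‖u‖ - |c| ≤ ‖u + c‖ := by
    have := norm_sub_norm_le u (-c)
    rwa [norm_neg, hcn, sub_neg_eq_add] at this
  have um : u - c ≠ 0 := norm_pos_iff.1 (hpos.trans_le nm)
  have up : u + c ≠ 0 := norm_pos_iff.1 (hpos.trans_le np)
  have hsq : u ^ 2 - (c : ℂ) ^ 2 = (u - c) * (u + c) := by ring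
  set F := futureIntegral x (u - c) H₁ with hFdef
  set P := pastIntegral x (u + c) H₁ with hPdef
  have cF : Continuous F := continuous_futureIntegral hx.continuous hm hint
  have cP : Continuous P := continuous_pastIntegral hx.continuous hp hint
  -- Variation of parameters after one integration by parts. In this form only `H₁ dx` has to be
  -- integrable, not `H dx`.
  refine ⟨fun t => H t / (u ^ 2 - c ^ 2) + 1 / (2 * u) * (F t / (u - c) - P t / (u + c)),
    fun t => c * H t / (u ^ 2 - c ^ 2) + 1 / 2 * (F t / (u - c) + P t / (u + c)),
    ⟨by fun_prop, by fun_prop, fun t ht => ?_, fun t ht => ?_⟩, fun t => ?_⟩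
  · have hF := hx.hasDerivAt_futureIntegral hm hH₁ hint ht
    have hP := hx.hasDerivAt_pastIntegral hp hH₁ hint ht
    refine (((hd t ht).div_const (u ^ 2 - c ^ 2)).add
      (((hF.div_const (u - c)).sub (hP.div_const (u + c))).const_mul (1 / (2 * u)))).congr_deriv ?_
    rw [← hFdef, ← hPdef, hsq]
    field_simp
    ring
  · have hF := hx.hasDerivAt_futureIntegral hm hH₁ hint ht
    have hP := hx.hasDerivAt_pastIntegral hp hH₁ hint ht
    refine ((((hd t ht).const_mul (c : ℂ)).div_const (u ^ 2 - c ^ 2)).add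
      (((hF.div_const (u - c)).add (hP.div_const (u + c))).const_mul (1 / 2))).congr_deriv ?_
    rw [← hFdef, ← hPdef, hsq]
    field_simp
    ring
  · have h1 := norm_futureIntegral_add_norm_pastIntegral_le hm hp hint t
    refine (norm_add_le _ _).trans (add_le_add le_rfl ?_)
    rw [norm_mul, norm_div, norm_mul, norm_one, Complex.norm_two]
    calc 1 / (2 * ‖u‖) * ‖F t / (u - c) - P t / (u + c)‖
        ≤ 1 / (2 * ‖u‖) * (‖F t‖ / (‖u‖ - |c|) + ‖P t‖ / (‖u‖ - |c|)) := by
          gcongr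
          refine (norm_sub_le _ _).trans ?_
          rw [norm_div, norm_div]
          gcongr
      _ = 1 / (2 * ‖u‖ * (‖u‖ - |c|)) * (‖F t‖ + ‖P t‖) := by field_simp
      _ ≤ _ := by gcongr

/-- Existence of a bounded solution of the system, with its bound, by successive
approximations. -/
theorem IsPiecewiseC1.exists_isPathSolution (hx : IsPiecewiseC1 x S) {c : ℝ} (hc : |c| < ‖u‖)
    (hm : Monotone fun t => ((u - c) * x t).re) (hp : Monotone fun t => ((u + c) * x t).re)
    (hΨ : Continuous Ψ) (hΨint : Integrable fun s => Ψ s * deriv x s)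
    (hΨu : 1 / (2 * ‖u‖) * (∫ s, ‖Ψ s * deriv x s‖) < 1)
    (hH : Continuous H) (hH₁ : Continuous H₁) (hd : ∀ t ∉ S, HasDerivAt H (H₁ t * deriv x t) t)
    (hint : Integrable fun s => H₁ s * deriv x s) {B : ℝ} (hB : ∀ t, ‖H t‖ ≤ B) :
    ∃ h k, IsPathSolution x S u c Ψ H h k ∧ ∀ t, ‖h t‖ ≤
      ‖H t / (u ^ 2 - c ^ 2)‖ + 1 / (2 * ‖u‖ * (‖u‖ - |c|)) * (∫ s, ‖H₁ s * deriv x s‖)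
      + 1 / (2 * ‖u‖) * (∫ s, ‖Ψ s * deriv x s‖)
        * ((1 - 1 / (2 * ‖u‖) * (∫ s, ‖Ψ s * deriv x s‖))⁻¹
          * (B / ‖u ^ 2 - c ^ 2‖
            + 1 / (2 * ‖u‖ * (‖u‖ - |c|)) * (∫ s, ‖H₁ s * deriv x s‖))) := by
  have hu : u ≠ 0 := norm_pos_iff.1 ((abs_nonneg c).trans_lt hc)
  obtain ⟨h₀, k₀, s₀, hb₀⟩ := hx.exists_isPathSolution_zero hc hm hp hH hH₁ hd hint
  set V := 1 / (2 * ‖u‖ * (‖u‖ - |c|)) * (∫ s, ‖H₁ s * deriv x s‖)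
  set κ := 1 / (2 * ‖u‖) * (∫ s, ‖Ψ s * deriv x s‖) with hκ
  have hκ0 : 0 ≤ κ := mul_nonneg (by positivity) (integral_nonneg fun _ => norm_nonneg _)
  set N := B / ‖u ^ 2 - (c : ℂ) ^ 2‖ + V
  have hN : ∀ t, ‖h₀ t‖ ≤ N := fun t => (hb₀ t).trans (by
    rw [norm_div]
    exact add_le_add (div_le_div_of_nonneg_right (hB t) (norm_nonneg _)) le_rfl)
  have hN0 : 0 ≤ N := (norm_nonneg _).trans (hN 0)
  have hi : ∀ h : BoundedContinuousFunction ℝ ℂ, Integrable fun s => Ψ s * h s * deriv x s :=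
    fun h => integrable_mul_mul_deriv h.continuous h.norm_coe_le_norm hΨint
  -- A fixed point satisfies `h = h₀ + pathKernel h`; the sup norm bound of the kernel makes `T` a
  -- `κ`-contraction.
  let T : BoundedContinuousFunction ℝ ℂ → BoundedContinuousFunction ℝ ℂ := fun h =>
    BoundedContinuousFunction.ofNormedAddCommGroup (fun t => h₀ t + pathKernel x u c Ψ h t)
      (s₀.continuous_left.add (continuous_pathKernel hx.continuous hm hp (hi h))) (N + κ * ‖h‖)
      (fun t => (norm_add_le _ _).trans (add_le_add (hN t)
        (norm_pathKernel_le hm hp h.continuous h.norm_coe_le_norm hΨint t)))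
  have hT : ContractingWith ⟨κ, hκ0⟩ T := by
    refine ⟨by exact_mod_cast hΨu, LipschitzWith.of_dist_le_mul fun f g => ?_⟩
    refine (BoundedContinuousFunction.dist_le (mul_nonneg hκ0 dist_nonneg)).2 fun t => ?_
    change dist (h₀ t + pathKernel x u c Ψ f t) (h₀ t + pathKernel x u c Ψ g t) ≤ κ * dist f g
    rw [dist_add_left, dist_eq_norm,
      ← pathKernel_sub hx.continuous hm hp (hi f) (hi g)]
    exact norm_pathKernel_le (h := fun s => f s - g s) hm hp (f.continuous.sub g.continuous)
      (fun t => (dist_eq_norm (f t) (g t)).symm.trans_le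
        (BoundedContinuousFunction.dist_coe_le_dist t)) hΨint t
  set h := ContractingWith.fixedPoint T hT
  have hfix : T h = h := hT.fixedPoint_isFixedPt
  have hfix' : ∀ t, h₀ t + pathKernel x u c Ψ h t = h t := fun t =>
    DFunLike.congr_fun hfix t
  obtain ⟨k₁, s₁⟩ := hx.exists_isPathSolution_pathKernel hu hm hp hΨ h.continuous (hi h)
  have hnorm : ‖h‖ ≤ (1 - κ)⁻¹ * N := by
    have h1 : ‖h‖ ≤ N + κ * ‖h‖ := by
      refine (BoundedContinuousFunction.norm_le (by positivity)).2 fun t => ?_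
      rw [← hfix' t]
      exact (norm_add_le _ _).trans (add_le_add (hN t)
        (norm_pathKernel_le hm hp h.continuous h.norm_coe_le_norm hΨint t))
    rw [inv_mul_eq_div, le_div_iff₀ (sub_pos.2 hΨu)]
    linarith
  refine ⟨h, fun t => k₀ t + k₁ t, ⟨h.continuous, s₀.continuous_right.add s₁.continuous_right,
    fun t ht => ?_, fun t ht => ?_⟩, fun t => ?_⟩
  · have := (s₀.hasDerivAt_left t ht).add (s₁.hasDerivAt_left t ht)
    have hfun : (h₀ + pathKernel x u c Ψ h) = h := funext hfix'
    rw [hfun] at this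
    refine this.congr_deriv ?_
    rw [← hfix' t]
    ring
  · refine ((s₀.hasDerivAt_right t ht).add (s₁.hasDerivAt_right t ht)).congr_deriv ?_
    linear_combination (u ^ 2 * deriv x t) * hfix' t
  -- Only the kernel term is estimated by the sup norm of `h`; `h₀` keeps its pointwise bound, so
  -- the value `H t` survives.
  · rw [← hfix' t]
    refine (norm_add_le _ _).trans (add_le_add (hb₀ t) ?_)
    exact norm_pathKernel_le hm hp h.continuous
      (fun s => (h.norm_coe_le_norm s).trans hnorm) hΨint t

/-- A bounded solution of the homogeneous system vanishes. -/
theorem IsPathSolution.eq_zero_of_bounded (hx : IsPiecewiseC1 x S) (hu : u ≠ 0)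
    (hm : Monotone fun t => ((u - c) * x t).re) (hp : Monotone fun t => ((u + c) * x t).re)
    (htop : Tendsto (fun t => ((u - c) * x t).re) atTop atTop)
    (hbot : Tendsto (fun t => ((u + c) * x t).re) atBot atBot)
    (hΨ : Continuous Ψ) (hΨint : Integrable fun s => Ψ s * deriv x s)
    (hΨu : 1 / (2 * ‖u‖) * (∫ s, ‖Ψ s * deriv x s‖) < 1)
    (s : IsPathSolution x S u c Ψ (fun _ => 0) h k) {B : ℝ} (hB : ∀ t, ‖h t‖ ≤ B) (t : ℝ) :
    h t = 0 := by
  have hi := integrable_mul_mul_deriv s.continuous_left hB hΨint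
  obtain ⟨k₁, s₁⟩ := hx.exists_isPathSolution_pathKernel hu hm hp hΨ s.continuous_left hi
  -- Removing the kernel part leaves constant coefficients, whence `2 u r = α e^{(u-c)x} - β
  -- e^{-(u+c)x}`.
  set r : ℝ → ℂ := fun t => h t - pathKernel x u c Ψ h t with hr
  set l : ℝ → ℂ := fun t => k t - k₁ t with hl
  have hx' := hx.continuous
  have cr : Continuous r := s.continuous_left.sub s₁.continuous_left
  have cl : Continuous l := s.continuous_right.sub s₁.continuous_right
  have dr : ∀ t ∉ S, HasDerivAt r ((l t - c * r t) * deriv x t) t := fun t ht =>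
    ((s.hasDerivAt_left t ht).sub (s₁.hasDerivAt_left t ht)).congr_deriv (by simp only [hr, hl]; ring)
  have dl : ∀ t ∉ S, HasDerivAt l ((u ^ 2 * r t - c * l t) * deriv x t) t := fun t ht =>
    ((s.hasDerivAt_right t ht).sub (s₁.hasDerivAt_right t ht)).congr_deriv
      (by simp only [hr, hl]; ring)
  have hα := Continuous.eq_of_hasDerivAt_zero_off_finset
    (v := fun t => (l t + u * r t) * Complex.exp (-((u - c) * x t))) (by fun_prop) S
    (fun t ht => by
      refine (((dl t ht).add ((dr t ht).const_mul u)).mul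
        ((hx.hasDerivAt t ht).const_mul (u - c)).neg.cexp).congr_deriv ?_
      simp only [Pi.add_apply, Pi.neg_apply]
      ring)
  have hβ := Continuous.eq_of_hasDerivAt_zero_off_finset
    (v := fun t => (l t - u * r t) * Complex.exp ((u + c) * x t)) (by fun_prop) S
    (fun t ht => by
      refine (((dl t ht).sub ((dr t ht).const_mul u)).mul
        ((hx.hasDerivAt t ht).const_mul (u + c)).cexp).congr_deriv ?_
      simp only [Pi.sub_apply]
      ring)
  set α := (l 0 + u * r 0) * Complex.exp (-((u - c) * x 0))
  set β := (l 0 - u * r 0) * Complex.exp ((u + c) * x 0)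
  have hα' : ∀ t, l t + u * r t = α * Complex.exp ((u - c) * x t) := fun t => by
    rw [show α = _ from (hα t 0).symm, mul_assoc, ← Complex.exp_add]; simp
  have hβ' : ∀ t, l t - u * r t = β * Complex.exp (-((u + c) * x t)) := fun t => by
    rw [show β = _ from (hβ t 0).symm, mul_assoc, ← Complex.exp_add]; simp
  have hrr : ∀ t, 2 * u * r t = α * Complex.exp ((u - c) * x t)
      - β * Complex.exp (-((u + c) * x t)) := fun t => by
    rw [← hα' t, ← hβ' t]; ring
  obtain ⟨M, hM⟩ : ∃ M, ∀ t, ‖2 * u * r t‖ ≤ M := by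
    refine ⟨2 * ‖u‖ * (B + 1 / (2 * ‖u‖) * (∫ s, ‖Ψ s * deriv x s‖) * B), fun t => ?_⟩
    rw [norm_mul, norm_mul, Complex.norm_two]
    gcongr
    exact (norm_sub_le _ _).trans (add_le_add (hB t)
      (norm_pathKernel_le hm hp s.continuous_left hB hΨint t))
  -- For `t ≥ 0` the `β` term does not exceed its modulus at `0`, while a nonzero `α` term is
  -- unbounded as `t → ∞`.
  have hα0 : α = 0 := by
    by_contra hne
    have h1 : Tendsto (fun t => ‖α‖ * Real.exp ((u - c) * x t).re) atTop atTop :=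
      (Real.tendsto_exp_atTop.comp htop).const_mul_atTop (norm_pos_iff.2 hne)
    obtain ⟨t, ht, ht0⟩ := ((h1.eventually_gt_atTop
      (M + ‖β‖ * Real.exp (-((u + c) * x 0).re))).and (eventually_ge_atTop 0)).exists
    have h2 : ‖α * Complex.exp ((u - c) * x t)‖
        ≤ ‖2 * u * r t‖ + ‖β * Complex.exp (-((u + c) * x t))‖ := by
      have := norm_add_le (2 * u * r t) (β * Complex.exp (-((u + c) * x t)))
      rwa [hrr t, sub_add_cancel, ← hrr t] at this
    rw [norm_mul, norm_mul β, Complex.norm_exp, Complex.norm_exp, Complex.neg_re] at h2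
    have h3 : ‖β‖ * Real.exp (-((u + c) * x t).re) ≤ ‖β‖ * Real.exp (-((u + c) * x 0).re) :=
      mul_le_mul_of_nonneg_left (Real.exp_le_exp.2 (neg_le_neg (hp ht0))) (norm_nonneg _)
    linarith [hM t]
  -- With `α = 0`, the growth as `t → -∞` excludes a nonzero `β`.
  have hβ0 : β = 0 := by
    by_contra hne
    have h1 : Tendsto (fun t => ‖β‖ * Real.exp (-((u + c) * x t).re)) atBot atTop :=
      (Real.tendsto_exp_atTop.comp (tendsto_neg_atBot_atTop.comp hbot)).const_mul_atTop
        (norm_pos_iff.2 hne)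
    obtain ⟨t, ht⟩ := (h1.eventually_gt_atTop M).exists
    have h2 := hM t
    rw [hrr t, hα0, zero_mul, zero_sub, norm_neg, norm_mul, Complex.norm_exp,
      Complex.neg_re] at h2
    linarith
  have hhK : ∀ t, h t = pathKernel x u c Ψ h t := fun t => by
    have h1 := hrr t
    rw [hα0, hβ0, zero_mul, zero_mul, sub_zero] at h1
    exact sub_eq_zero.1 ((mul_eq_zero.1 h1).resolve_left (by simpa using hu))
  set κ := 1 / (2 * ‖u‖) * (∫ s, ‖Ψ s * deriv x s‖) with hκ
  have hbdd : BddAbove (range fun t => ‖h t‖) := ⟨B, by rintro _ ⟨t, rfl⟩; exact hB t⟩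
  set N := ⨆ t, ‖h t‖
  have hN : ∀ t, ‖h t‖ ≤ N := fun t => le_ciSup hbdd t
  have hN' : N ≤ κ * N := ciSup_le fun t => by
    rw [hhK t]
    exact norm_pathKernel_le hm hp s.continuous_left hN hΨint t
  have hN0 : 0 ≤ N := (norm_nonneg _).trans (hN 0)
  have : N ≤ 0 := by nlinarith
  exact norm_le_zero_iff.1 ((hN t).trans this)

end

/-! ### The Liouville transformation and the remainder equation -/

namespace LiouvilleGreen

section

variable {D : Set ℂ} {f g p ξ q : ℂ → ℂ}

theorem IsLiouvilleVariable.q_ne_zero (hξ : IsLiouvilleVariable D f ξ q) {z : ℂ} (hz : z ∈ D) :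
    q z ≠ 0 := fun h => hξ.ne_zero z hz (by rw [← hξ.q_pow_four z hz, h]; simp)

theorem IsLiouvilleVariable.deriv_xi_ne_zero (hξ : IsLiouvilleVariable D f ξ q) {z : ℂ}
    (hz : z ∈ D) : deriv ξ z ≠ 0 :=
  fun h => hξ.ne_zero z hz (by rw [← hξ.deriv_xi_sq z hz, h]; simp)

theorem IsLiouvilleVariable.differentiableOn_derivXi (hξ : IsLiouvilleVariable D f ξ q)
    (hD : IsOpen D) {h : ℂ → ℂ} (hh : DifferentiableOn ℂ h D) :
    DifferentiableOn ℂ (derivXi ξ h) D :=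
  (hh.deriv hD).div (hξ.differentiableOn_xi.deriv hD) fun _ hz => hξ.deriv_xi_ne_zero hz

theorem IsLiouvilleVariable.differentiableOn_psi (hξ : IsLiouvilleVariable D f ξ q)
    (hD : IsOpen D) (hf : DifferentiableOn ℂ f D) (hg : DifferentiableOn ℂ g D) :
    DifferentiableOn ℂ (psi f g) D := by
  have h1 := hf.deriv hD
  have h2 := h1.deriv hD
  refine DifferentiableOn.add (DifferentiableOn.div (by fun_prop) (by fun_prop) fun z hz => ?_)
    (hg.div hf hξ.ne_zero)
  exact mul_ne_zero (by norm_num) (pow_ne_zero _ (hξ.ne_zero z hz))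

theorem IsLiouvilleVariable.differentiableOn_coeff (hξ : IsLiouvilleVariable D f ξ q)
    (hD : IsOpen D) (hf : DifferentiableOn ℂ f D) (hg : DifferentiableOn ℂ g D)
    (hp : DifferentiableOn ℂ p D) (n : ℕ) : DifferentiableOn ℂ (coeff f g p ξ q n) D := by
  induction n with
  | zero =>
    exact (hp.div (hξ.differentiableOn_q.pow 3) fun z hz => pow_ne_zero _ (hξ.q_ne_zero hz)).neg
  | succ n ih =>
    exact (hξ.differentiableOn_derivXi hD (hξ.differentiableOn_derivXi hD ih)).sub
      ((hξ.differentiableOn_psi hD hf hg).mul ih)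

theorem IsLiouvilleVariable.differentiableOn_scaledCoeff (hξ : IsLiouvilleVariable D f ξ q)
    (hD : IsOpen D) (hf : DifferentiableOn ℂ f D) (hg : DifferentiableOn ℂ g D)
    (hp : DifferentiableOn ℂ p D) (c : ℝ) (n : ℕ) :
    DifferentiableOn ℂ (scaledCoeff f g p ξ q c n) D :=
  (hξ.differentiableOn_xi.const_mul (-(c : ℂ))).cexp.mul
    (hξ.differentiableOn_coeff hD hf hg hp n)

theorem derivXi_congr (hD : IsOpen D) {h₁ h₂ : ℂ → ℂ} (h : Set.EqOn h₁ h₂ D) :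
    Set.EqOn (derivXi ξ h₁) (derivXi ξ h₂) D := fun z hz => by
  rw [derivXi, derivXi, (Filter.eventuallyEq_of_mem (hD.mem_nhds hz) h).deriv_eq]

theorem derivXi_sub_const_mul (hD : IsOpen D) {h₁ h₂ : ℂ → ℂ} (hd₁ : DifferentiableOn ℂ h₁ D)
    (hd₂ : DifferentiableOn ℂ h₂ D) (a : ℂ) :
    Set.EqOn (derivXi ξ fun z => h₁ z - a * h₂ z) (fun z => derivXi ξ h₁ z - a * derivXi ξ h₂ z)
      D := fun z hz => by
  have e₁ := (hd₁.differentiableAt (hD.mem_nhds hz)).hasDerivAt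
  have e₂ := (hd₂.differentiableAt (hD.mem_nhds hz)).hasDerivAt
  simp only [derivXi]
  rw [(e₁.fun_sub (e₂.const_mul a)).deriv]
  ring

theorem IsLiouvilleVariable.derivXi_q_mul (hξ : IsLiouvilleVariable D f ξ q) (hD : IsOpen D)
    {w : ℂ → ℂ} (hw : DifferentiableOn ℂ w D) :
    Set.EqOn (derivXi ξ fun z => q z * w z)
      (fun z => (deriv q z * w z + q z * deriv w z) / deriv ξ z) D := fun z hz => by
  have e₁ := (hξ.differentiableOn_q.differentiableAt (hD.mem_nhds hz)).hasDerivAt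
  have e₂ := (hw.differentiableAt (hD.mem_nhds hz)).hasDerivAt
  simp only [derivXi]
  rw [(e₁.fun_mul e₂).deriv]

/-- The Liouville transformation of the differential expression. -/
theorem IsLiouvilleVariable.derivXi_derivXi_q_mul (hξ : IsLiouvilleVariable D f ξ q)
    (hD : IsOpen D) {w : ℂ → ℂ} (hw : DifferentiableOn ℂ w D) {z : ℂ} (hz : z ∈ D) :
    derivXi ξ (derivXi ξ fun z => q z * w z) z
      = (psi f g z - g z / f z) * (q z * w z) + deriv (deriv w) z / q z ^ 3 := by
  have hz' := hD.mem_nhds hz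
  have dq := fun y hy => (hξ.differentiableOn_q.differentiableAt (hD.mem_nhds (x := y) hy)).hasDerivAt
  have dq' := ((hξ.differentiableOn_q.deriv hD).differentiableAt hz').hasDerivAt
  have dw := (hw.differentiableAt hz').hasDerivAt
  have dw' := ((hw.deriv hD).differentiableAt hz').hasDerivAt
  have dξ' := ((hξ.differentiableOn_xi.deriv hD).differentiableAt hz').hasDerivAt
  have hq0 := hξ.q_ne_zero hz
  have hξ0 := hξ.deriv_xi_ne_zero hz
  have hf1 : Set.EqOn (deriv f) (fun y => 4 * q y ^ 3 * deriv q y) D := fun y hy => by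
    have : f =ᶠ[𝓝 y] fun y => q y ^ 4 :=
      Filter.eventuallyEq_of_mem (hD.mem_nhds hy) fun y hy => (hξ.q_pow_four y hy).symm
    rw [this.deriv_eq, ((dq y hy).fun_pow 4).deriv]
    norm_num
  have hf2 : deriv (deriv f) z = 12 * q z ^ 2 * deriv q z ^ 2 + 4 * q z ^ 3 * deriv (deriv q) z := by
    rw [(Filter.eventuallyEq_of_mem hz' hf1).deriv_eq,
      ((((dq z hz).fun_pow 3).const_mul 4).fun_mul dq').deriv]
    norm_num
    ring
  -- The branches give `(ξ')² = q⁴` but leave the sign in `ξ' = ± q²` free; the computation is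
  -- arranged so that only even powers of `ξ'` remain.
  have hξ2 : deriv ξ z * deriv (deriv ξ) z = 2 * q z ^ 3 * deriv q z := by
    have h1 := (dξ'.fun_pow 2).deriv
    rw [(Filter.eventuallyEq_of_mem hz' fun y hy => hξ.deriv_xi_sq y hy).deriv_eq, hf1 hz] at h1
    norm_num at h1
    linear_combination -h1 / 2
  have hsq : deriv ξ z ^ 2 = q z ^ 4 := by rw [hξ.deriv_xi_sq z hz, hξ.q_pow_four z hz]
  have hfz : f z = q z ^ 4 := (hξ.q_pow_four z hz).symm
  rw [derivXi_congr hD (hξ.derivXi_q_mul hD hw) hz, derivXi,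
    (((dq'.fun_mul dw).fun_add ((dq z hz).fun_mul dw')).fun_div dξ' hξ0).deriv, psi, add_sub_cancel_right, hf2,
    hf1 hz, hfz]
  have hs : deriv (deriv ξ) z = 2 * q z ^ 3 * deriv q z / deriv ξ z := by
    rw [eq_div_iff hξ0, ← hξ2]; ring
  rw [hs]
  have h4 : deriv ξ z ^ 4 = q z ^ 8 := by
    calc deriv ξ z ^ 4 = (deriv ξ z ^ 2) ^ 2 := by ring
      _ = _ := by rw [hsq]; ring
  set s := deriv ξ z
  calc _ = (deriv (deriv q) z * w z + deriv q z * deriv w z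
        + (deriv q z * deriv w z + q z * deriv (deriv w) z)) / s ^ 2
        - (deriv q z * w z + q z * deriv w z) * (2 * q z ^ 3 * deriv q z) / s ^ 4 := by
        field_simp
    _ = _ := by
        rw [hsq, h4]
        field_simp
        ring

/-- The remainder after `n` terms of the expansion of a function `w`. -/
noncomputable def remainder (f g p ξ q : ℂ → ℂ) (u : ℂ) (n : ℕ) (w : ℂ → ℂ) (z : ℂ) : ℂ :=
  q z * w z - 1 / u ^ 2 * ∑ s ∈ Finset.range n, coeff f g p ξ q s z / u ^ (2 * s)

theorem IsLiouvilleVariable.differentiableOn_sum_coeff (hξ : IsLiouvilleVariable D f ξ q)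
    (hD : IsOpen D) (hf : DifferentiableOn ℂ f D) (hg : DifferentiableOn ℂ g D)
    (hp : DifferentiableOn ℂ p D) (u : ℂ) (n : ℕ) :
    DifferentiableOn ℂ (fun z => ∑ s ∈ Finset.range n, coeff f g p ξ q s z / u ^ (2 * s)) D :=
  DifferentiableOn.fun_sum fun s _ => (hξ.differentiableOn_coeff hD hf hg hp s).div_const _

theorem IsLiouvilleVariable.differentiableOn_remainder (hξ : IsLiouvilleVariable D f ξ q)
    (hD : IsOpen D) (hf : DifferentiableOn ℂ f D) (hg : DifferentiableOn ℂ g D)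
    (hp : DifferentiableOn ℂ p D) (u : ℂ) (n : ℕ) {w : ℂ → ℂ} (hw : DifferentiableOn ℂ w D) :
    DifferentiableOn ℂ (remainder f g p ξ q u n w) D :=
  (hξ.differentiableOn_q.mul hw).sub
    ((hξ.differentiableOn_sum_coeff hD hf hg hp u n).const_mul _)

/-- The remainder of a solution satisfies an inhomogeneous equation with right-hand side of order
`u^{-2n}`. -/
theorem IsLiouvilleVariable.derivXi_derivXi_remainder (hξ : IsLiouvilleVariable D f ξ q)
    (hD : IsOpen D) (hf : DifferentiableOn ℂ f D) (hg : DifferentiableOn ℂ g D)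
    (hp : DifferentiableOn ℂ p D) {u : ℂ} (hu : u ≠ 0) {w : ℂ → ℂ} (hw : DifferentiableOn ℂ w D)
    (hw' : ∀ z ∈ D, deriv (deriv w) z - (u ^ 2 * f z + g z) * w z = p z) (n : ℕ) :
    ∀ z ∈ D, derivXi ξ (derivXi ξ (remainder f g p ξ q u n w)) z
      = (u ^ 2 + psi f g z) * remainder f g p ξ q u n w z - coeff f g p ξ q n z / u ^ (2 * n) := by
  induction n with
  | zero =>
    intro z hz
    have h0 : remainder f g p ξ q u 0 w = fun z => q z * w z := by ext; simp [remainder]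
    have hq0 := hξ.q_ne_zero hz
    rw [h0, hξ.derivXi_derivXi_q_mul (g := g) hD hw hz, eq_add_of_sub_eq (hw' z hz), coeff,
      ← hξ.q_pow_four z hz]
    field_simp
    ring
  | succ n ih =>
    intro z hz
    have dn := hξ.differentiableOn_remainder hD hf hg hp u n hw
    have dG := hξ.differentiableOn_coeff hD hf hg hp n
    have h1 : remainder f g p ξ q u (n + 1) w = fun z =>
        remainder f g p ξ q u n w z - 1 / u ^ (2 * n + 2) * coeff f g p ξ q n z := by
      ext z
      simp only [remainder, Finset.sum_range_succ]
      field_simp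
      ring
    rw [h1, derivXi_congr hD (derivXi_sub_const_mul hD dn dG _) hz,
      derivXi_sub_const_mul hD (hξ.differentiableOn_derivXi hD dn)
        (hξ.differentiableOn_derivXi hD dG) _ hz]
    beta_reduce
    -- The part `u² G_n / u^{2n+2}` cancels the old forcing term and leaves `-(G_n'' - ψ G_n) /
    -- u^{2n+2}`.
    rw [ih z hz, coeff]
    field_simp
    ring

end

/-! ### Restriction to a path -/

section Path

variable {D : Set ℂ} {f g p ξ q : ℂ → ℂ} {γ : ℝ → ℂ} {S : Finset ℝ}

/-- Off the break points, differentiation along a path in terms of the Liouville variable. -/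
theorem IsLiouvilleVariable.hasDerivAt_comp (hξ : IsLiouvilleVariable D f ξ q) (hD : IsOpen D)
    {h : ℂ → ℂ} (hh : DifferentiableOn ℂ h D) {t : ℝ} (ht : γ t ∈ D)
    (hγ : DifferentiableAt ℝ γ t) :
    HasDerivAt (fun s => h (γ s)) (derivXi ξ h (γ t) * deriv (fun s => ξ (γ s)) t) t := by
  have hh' := (hh.differentiableAt (hD.mem_nhds ht)).hasDerivAt
  have hx' := (hξ.differentiableOn_xi.differentiableAt (hD.mem_nhds ht)).hasDerivAt
  have e1 : HasDerivAt (fun s => h (γ s)) (deriv h (γ t) * deriv γ t) t :=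
    hh'.comp_of_eq t hγ.hasDerivAt rfl
  have e2 : HasDerivAt (fun s => ξ (γ s)) (deriv ξ (γ t) * deriv γ t) t :=
    hx'.comp_of_eq t hγ.hasDerivAt rfl
  have h0 := hξ.deriv_xi_ne_zero ht
  rw [e2.deriv, derivXi]
  refine e1.congr_deriv ?_
  field_simp

theorem exists_Ioo_disjoint (S : Finset ℝ) (t : ℝ) :
    ∃ δ > 0, ∀ s ∈ Set.Ioo (t - δ) (t + δ), s ≠ t → s ∉ S := by
  have h := S.eventually_notMem_nhdsNE t
  rw [eventually_nhdsWithin_iff, Metric.eventually_nhds_iff] at h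
  obtain ⟨δ, hδ, h⟩ := h
  refine ⟨δ, hδ, fun s hs hst => h (y := s) ?_ hst⟩
  rw [Real.dist_eq, abs_lt]
  constructor <;> linarith [hs.1, hs.2]

/-- Each arc is `C²` up to its closed ends, so the derivative may jump at a break point but is
bounded on either side of it. -/
theorem IsLiouvilleVariable.isPiecewiseC1 (hξ : IsLiouvilleVariable D f ξ q) (hD : IsOpen D)
    (hγ : Continuous γ) (hmem : ∀ t, γ t ∈ D)
    (hS : ∀ a b : ℝ, a < b → (∀ τ ∈ Set.Ioo a b, τ ∉ S) → ContDiffOn ℝ 2 γ (Set.Icc a b)) :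
    IsPiecewiseC1 (fun t => ξ (γ t)) S := by
  have hξR : ContDiffOn ℝ 2 ξ D := (hξ.differentiableOn_xi.contDiffOn hD).restrict_scalars ℝ
  have hx : ∀ a b : ℝ, a < b → (∀ τ ∈ Set.Ioo a b, τ ∉ S) →
      ContDiffOn ℝ 2 (fun t => ξ (γ t)) (Set.Icc a b) := fun a b hab h =>
    hξR.comp (hS a b hab h) fun t _ => hmem t
  have hint : ∀ t ∉ S, ∃ δ > 0, ContDiffOn ℝ 2 (fun t => ξ (γ t)) (Set.Ioo (t - δ) (t + δ)) := by
    intro t ht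
    obtain ⟨δ, hδ, h⟩ := exists_Ioo_disjoint S t
    refine ⟨δ, hδ, (hx (t - δ) (t + δ) (by linarith) fun s hs => ?_).mono Set.Ioo_subset_Icc_self⟩
    rcases eq_or_ne s t with rfl | hst
    exacts [ht, h s hs hst]
  have hbd : ∀ a b : ℝ, a < b → (∀ τ ∈ Set.Ioo a b, τ ∉ S) →
      ∃ C, ∀ s ∈ Set.Ioo a b, ‖deriv (fun t => ξ (γ t)) s‖ ≤ C := by
    intro a b hab h
    obtain ⟨C, hC⟩ := isCompact_Icc.exists_bound_of_continuousOn
      ((hx a b hab h).continuousOn_derivWithin (uniqueDiffOn_Icc hab) (by norm_num))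
    refine ⟨C, fun s hs => ?_⟩
    rw [← derivWithin_of_mem_nhds (Icc_mem_nhds hs.1 hs.2)]
    exact hC s (Set.Ioo_subset_Icc_self hs)
  refine ⟨hξ.differentiableOn_xi.continuousOn.comp_continuous hγ hmem, fun t ht => ?_,
    fun t ht => ?_, fun t => ?_⟩
  · obtain ⟨δ, hδ, h⟩ := hint t ht
    exact ((h.differentiableOn (by norm_num)).differentiableAt
      (Ioo_mem_nhds (by linarith) (by linarith))).hasDerivAt
  · obtain ⟨δ, hδ, h⟩ := hint t ht
    exact (h.continuousOn_deriv_of_isOpen isOpen_Ioo (by norm_num)).continuousAt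
      (Ioo_mem_nhds (by linarith) (by linarith))
  · obtain ⟨δ, hδ, h⟩ := exists_Ioo_disjoint S t
    obtain ⟨C₁, h₁⟩ := hbd (t - δ) t (by linarith) fun s hs =>
      h s ⟨hs.1, by linarith [hs.2]⟩ hs.2.ne
    obtain ⟨C₂, h₂⟩ := hbd t (t + δ) (by linarith) fun s hs =>
      h s ⟨by linarith [hs.1], hs.2⟩ hs.1.ne'
    refine ⟨max C₁ C₂, ?_⟩
    rw [eventually_nhdsWithin_iff]
    filter_upwards [Ioo_mem_nhds (show t - δ < t by linarith) (show t < t + δ by linarith)]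
      with s hs hst
    rcases lt_or_gt_of_ne hst with hlt | hgt
    · exact (h₁ s ⟨hs.1, hlt⟩).trans (le_max_left _ _)
    · exact (h₂ s ⟨hgt, hs.2⟩).trans (le_max_right _ _)

theorem differentiableAt_of_contDiffOn_arcs
    (hS : ∀ a b : ℝ, a < b → (∀ τ ∈ Set.Ioo a b, τ ∉ S) → ContDiffOn ℝ 2 γ (Set.Icc a b))
    {t : ℝ} (ht : t ∉ S) : DifferentiableAt ℝ γ t := by
  obtain ⟨δ, hδ, h⟩ := exists_Ioo_disjoint S t
  refine ((hS (t - δ) (t + δ) (by linarith) fun s hs => ?_).differentiableOn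
    (by norm_num)).differentiableAt (Icc_mem_nhds (by linarith) (by linarith))
  rcases eq_or_ne s t with rfl | hst
  exacts [ht, h s hs hst]

/-- The restriction to a path of a solution of `E'' = (u² + ψ) E - R`, where primes are derivatives
with respect to the Liouville variable. -/
theorem IsLiouvilleVariable.isPathSolution (hξ : IsLiouvilleVariable D f ξ q) (hD : IsOpen D)
    (hγ : Continuous γ) (hmem : ∀ t, γ t ∈ D) (hγd : ∀ t ∉ S, DifferentiableAt ℝ γ t)
    (hx : IsPiecewiseC1 (fun t => ξ (γ t)) S) {E R : ℂ → ℂ} (hE : DifferentiableOn ℂ E D)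
    {u : ℂ} (hER : ∀ z ∈ D, derivXi ξ (derivXi ξ E) z = (u ^ 2 + psi f g z) * E z - R z) (c : ℂ) :
    IsPathSolution (fun t => ξ (γ t)) S u c (fun t => psi f g (γ t))
      (fun t => Complex.exp (-c * ξ (γ t)) * R (γ t))
      (fun t => Complex.exp (-c * ξ (γ t)) * E (γ t))
      (fun t => Complex.exp (-c * ξ (γ t)) * derivXi ξ E (γ t)) := by
  have hE' := hξ.differentiableOn_derivXi hD hE
  have cx := hx.continuous
  have cexp : Continuous fun t => Complex.exp (-c * ξ (γ t)) :=
    Complex.continuous_exp.comp (continuous_const.mul cx)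
  refine ⟨cexp.mul (hE.continuousOn.comp_continuous hγ hmem),
    cexp.mul (hE'.continuousOn.comp_continuous hγ hmem), fun t ht => ?_, fun t ht => ?_⟩
  · refine (((hx.hasDerivAt t ht).const_mul (-c)).cexp.mul
      (hξ.hasDerivAt_comp hD hE (hmem t) (hγd t ht))).congr_deriv ?_
    ring
  · refine (((hx.hasDerivAt t ht).const_mul (-c)).cexp.mul
      (hξ.hasDerivAt_comp hD hE' (hmem t) (hγd t ht))).congr_deriv ?_
    rw [hER _ (hmem t)]
    ring

end Path

end LiouvilleGreen

/-! ### The error bound and the passage between path and domain -/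

theorem IsPathSolution.const_mul {x : ℝ → ℂ} {S : Finset ℝ} {u c : ℂ} {Ψ H h k : ℝ → ℂ}
    (s : IsPathSolution x S u c Ψ H h k) (a : ℂ) :
    IsPathSolution x S u c Ψ (fun t => a * H t) (fun t => a * h t) (fun t => a * k t) where
  continuous_left := continuous_const.mul s.continuous_left
  continuous_right := continuous_const.mul s.continuous_right
  hasDerivAt_left t ht := ((s.hasDerivAt_left t ht).const_mul a).congr_deriv (by ring)
  hasDerivAt_right t ht := ((s.hasDerivAt_right t ht).const_mul a).congr_deriv (by ring)

/-- A continuous function on the line that is bounded at infinity is bounded. -/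
theorem Continuous.exists_bound_of_isBigO_one {E : Type*} [NormedAddCommGroup E] {h : ℝ → E}
    (hh : Continuous h) (hO : h =O[cocompact ℝ] fun _ => (1 : ℝ)) : ∃ C, ∀ t, ‖h t‖ ≤ C := by
  obtain ⟨C, hC⟩ := hO.bound
  obtain ⟨K, hK, hKC⟩ := mem_cocompact.1 hC
  obtain ⟨C', hC'⟩ := hK.exists_bound_of_continuousOn hh.continuousOn
  refine ⟨max C C', fun t => ?_⟩
  by_cases ht : t ∈ K
  · exact (hC' t ht).trans (le_max_right _ _)
  · have := hKC ht
    simp only [Set.mem_ofPred_eq, norm_one, mul_one] at this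
    exact this.trans (le_max_left _ _)

namespace LiouvilleGreen

variable {Z D : Set ℂ} {f g p ξ q : ℂ → ℂ} {γ : ℝ → ℂ} {S : Finset ℝ}

/-- Since `q` has no zeros, the expansion forces the error function on `D`; the quantifier over `ε`
leaves no freedom there. -/
theorem hasExpansion_iff (hξ : IsLiouvilleVariable D f ξ q) (u : ℂ) (n : ℕ) (w ε : ℂ → ℂ) :
    HasExpansion D f g p ξ q u n w ε ↔ ∀ z ∈ D, remainder f g p ξ q u n w z = ε z := by
  refine forall₂_congr fun z hz => ?_
  have := hξ.q_ne_zero hz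
  rw [remainder, sub_eq_iff_eq_add', one_div (q z), eq_inv_mul_iff_mul_eq₀ this]

theorem coeff_eq_exp_mul_scaledCoeff (c : ℝ) (n : ℕ) (z : ℂ) :
    coeff f g p ξ q n z = Complex.exp (c * ξ z) * scaledCoeff f g p ξ q c n z := by
  rw [scaledCoeff, ← mul_assoc, ← Complex.exp_add]
  simp

/-- The error bound with the exponential factor and the powers of `u` taken out. -/
theorem errorBound_eq {u : ℂ} (hu : u ≠ 0) (c : ℝ) (hc : |c| < ‖u‖) (n : ℕ) (t : ℝ) :
    errorBound f g p ξ q u c n γ (γ t) =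
      ‖Complex.exp (c * ξ (γ t))‖ / ‖u‖ ^ (2 * n) *
      (‖scaledCoeff f g p ξ q c n (γ t) / (u ^ 2 - c ^ 2)‖
        + 1 / (2 * ‖u‖ * (‖u‖ - |c|))
          * pathIntegral ξ γ (derivXi ξ (scaledCoeff f g p ξ q c n))
        + 1 / (2 * ‖u‖) * pathIntegral ξ γ (psi f g)
          * ((1 - 1 / (2 * ‖u‖) * pathIntegral ξ γ (psi f g))⁻¹
            * ((⨆ τ : ℝ, ‖scaledCoeff f g p ξ q c n (γ τ)‖) / ‖u ^ 2 - (c : ℂ) ^ 2‖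
              + 1 / (2 * ‖u‖ * (‖u‖ - |c|))
                * pathIntegral ξ γ (derivXi ξ (scaledCoeff f g p ξ q c n))))) := by
  have hu' : ‖u‖ ≠ 0 := norm_ne_zero_iff.2 hu
  have hc' : ‖u‖ - |c| ≠ 0 := (sub_pos.2 hc).ne'
  have hsq : ‖u ^ 2 - (c : ℂ) ^ 2‖ ≠ 0 := by
    rw [norm_ne_zero_iff, sub_ne_zero]
    intro h
    have := congrArg norm h
    rw [norm_pow, norm_pow, Complex.norm_real, Real.norm_eq_abs] at this
    exact hc.ne' ((pow_left_inj₀ (norm_nonneg _) (abs_nonneg _) two_ne_zero).1 this)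
  rw [errorBound, boundL, coeff_eq_exp_mul_scaledCoeff c]
  simp only [norm_div, norm_mul, norm_pow]
  generalize (1 - 1 / (2 * ‖u‖) * pathIntegral ξ γ (psi f g))⁻¹ = K
  generalize ‖u ^ 2 - (c : ℂ) ^ 2‖ = d at *
  generalize ‖u‖ - |c| = e at *
  field_simp
  ring

/-- Divided by `|e^{cξ}|`, the error bound is uniform along the path. Uniqueness uses nothing finer
than this. -/
theorem exists_errorBound_le_mul {u : ℂ} (hu : u ≠ 0) {c : ℝ} (hc : |c| < ‖u‖) {n : ℕ}
    {C : ℝ} (hC : ∀ t, ‖scaledCoeff f g p ξ q c n (γ t)‖ ≤ C) :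
    ∃ B, ∀ t, errorBound f g p ξ q u c n γ (γ t) ≤ ‖Complex.exp (c * ξ (γ t))‖ * B := by
  have h := fun t => errorBound_eq (f := f) (g := g) (p := p) (q := q) (ξ := ξ) (γ := γ) hu c hc n t
  simp only [add_assoc (‖_‖)] at h
  generalize 1 / (2 * ‖u‖ * (‖u‖ - |c|)) * pathIntegral ξ γ
    (derivXi ξ (scaledCoeff f g p ξ q c n)) + _ = K at h
  refine ⟨1 / ‖u‖ ^ (2 * n) * (C / ‖u ^ 2 - (c : ℂ) ^ 2‖ + K), fun t => ?_⟩
  rw [h, ← mul_assoc, mul_one_div, norm_div]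
  have := hC t
  gcongr

theorem IsProgressivePath.exists_break_points {u : ℂ} {c : ℝ}
    (hγ : IsProgressivePath D ξ u c γ) (hξ : IsLiouvilleVariable D f ξ q) (hD : IsOpen D) :
    ∃ S : Finset ℝ, IsPiecewiseC1 (fun t => ξ (γ t)) S ∧ ∀ t ∉ S, DifferentiableAt ℝ γ t := by
  obtain ⟨S, hS⟩ := hγ.isR2Path.arcs
  exact ⟨S, hξ.isPiecewiseC1 hD hγ.isR2Path.continuous hγ.mem fun a b hab h => (hS a b hab h).1,
    fun t ht => differentiableAt_of_contDiffOn_arcs (fun a b hab h => (hS a b hab h).1) ht⟩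

theorem pathIntegral_eq (h : ℂ → ℂ) :
    pathIntegral ξ γ h = ∫ t, ‖h (γ t) * deriv (fun s => ξ (γ s)) t‖ := by
  simp only [pathIntegral, pathDensity, norm_mul]

theorem PathIntegrable.integrable {h : ℂ → ℂ} (hi : PathIntegrable ξ γ h)
    (hh : Continuous fun t => h (γ t)) :
    MeasureTheory.Integrable fun t => h (γ t) * deriv (fun s => ξ (γ s)) t := by
  refine (MeasureTheory.integrable_norm_iff (hh.aestronglyMeasurable.mul
    (stronglyMeasurable_deriv _).aestronglyMeasurable)).1 ?_
  exact MeasureTheory.Integrable.congr hi (Eventually.of_forall fun t => (norm_mul _ _).symm)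

/-- The remainder of a solution of the equation, restricted to a path. -/
theorem IsParticularSolution.isPathSolution {u : ℂ} {w : ℂ → ℂ}
    (hw : IsParticularSolution Z f g p u w) (hu : u ≠ 0) (hD : IsOpen D) (hDZ : D ⊆ Z)
    (hξ : IsLiouvilleVariable D f ξ q)
    (hf : DifferentiableOn ℂ f D) (hg : DifferentiableOn ℂ g D) (hp : DifferentiableOn ℂ p D)
    (hγ : Continuous γ) (hmem : ∀ t, γ t ∈ D) (hx : IsPiecewiseC1 (fun t => ξ (γ t)) S)
    (hγd : ∀ t ∉ S, DifferentiableAt ℝ γ t) (c : ℝ) (n : ℕ) :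
    IsPathSolution (fun t => ξ (γ t)) S u c (fun t => psi f g (γ t))
      (fun t => 1 / u ^ (2 * n) * scaledCoeff f g p ξ q c n (γ t))
      (fun t => Complex.exp (-c * ξ (γ t)) * remainder f g p ξ q u n w (γ t))
      (fun t => Complex.exp (-c * ξ (γ t)) * derivXi ξ (remainder f g p ξ q u n w) (γ t)) := by
  have hwD := hw.1.mono hDZ
  have := hξ.isPathSolution hD hγ hmem hγd hx
    (hξ.differentiableOn_remainder hD hf hg hp u n hwD)
    (hξ.derivXi_derivXi_remainder hD hf hg hp hu hwD (fun z hz => hw.2 z (hDZ hz)) n) (c : ℂ)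
  convert! this using 2 with t
  rw [scaledCoeff]
  ring

/-- There is a solution of the equation whose remainder has given initial data at a point. -/
theorem exists_isParticularSolution_remainder (hZ : IsOpen Z) (hZsc : IsSimplyConnected Z)
    (hf : DifferentiableOn ℂ f Z) (hg : DifferentiableOn ℂ g Z) (hp : DifferentiableOn ℂ p Z)
    (hD : IsOpen D) (hDZ : D ⊆ Z) (hξ : IsLiouvilleVariable D f ξ q) (u : ℂ) (n : ℕ) {z₀ : ℂ}
    (hz₀ : z₀ ∈ D) (a b : ℂ) :
    ∃ w, IsParticularSolution Z f g p u w ∧ remainder f g p ξ q u n w z₀ = a ∧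
      derivXi ξ (remainder f g p ξ q u n w) z₀ = b := by
  set T : ℂ → ℂ := fun z => ∑ s ∈ Finset.range n, coeff f g p ξ q s z / u ^ (2 * s)
  have dT : DifferentiableOn ℂ T D :=
    hξ.differentiableOn_sum_coeff hD (hf.mono hDZ) (hg.mono hDZ) (hp.mono hDZ) u n
  have hq0 := hξ.q_ne_zero hz₀
  have hξ0 := hξ.deriv_xi_ne_zero hz₀
  -- The data for `w` come from inverting `q w = a + u⁻² T` and its first derivative at `z₀`.
  set w₀ := (a + 1 / u ^ 2 * T z₀) / q z₀
  obtain ⟨w, w', hw0, hw0', hw⟩ := exists_hasDerivAt_linear_second_order hZ hZsc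
    (F := fun z => u ^ 2 * f z + g z) ((hf.const_mul _).add hg) hp (hDZ hz₀) w₀
    (((b + 1 / u ^ 2 * derivXi ξ T z₀) * deriv ξ z₀ - deriv q z₀ * w₀) / q z₀)
  have dw : DifferentiableOn ℂ w Z := fun z hz =>
    (hw z hz).1.differentiableAt.differentiableWithinAt
  have hderiv : Set.EqOn (deriv w) w' Z := fun z hz => (hw z hz).1.deriv
  refine ⟨w, ⟨dw, fun z hz => ?_⟩, ?_, ?_⟩
  · rw [(Filter.eventuallyEq_of_mem (hZ.mem_nhds hz) hderiv).deriv_eq, (hw z hz).2.deriv]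
    ring
  · rw [remainder, hw0]
    change q z₀ * ((a + 1 / u ^ 2 * T z₀) / q z₀) - 1 / u ^ 2 * T z₀ = a
    rw [mul_div_cancel₀ _ hq0]
    ring
  · have h1 : derivXi ξ (remainder f g p ξ q u n w) z₀
        = derivXi ξ (fun z => q z * w z) z₀ - 1 / u ^ 2 * derivXi ξ T z₀ :=
      derivXi_sub_const_mul hD (hξ.differentiableOn_q.mul (dw.mono hDZ)) dT (1 / u ^ 2) hz₀
    rw [h1, hξ.derivXi_q_mul hD (dw.mono hDZ) hz₀]
    beta_reduce
    rw [hderiv (hDZ hz₀), hw0, hw0']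
    field_simp
    ring

/-- A progressive path accumulates at each of its points. -/
theorem IsProgressivePath.accPt {u : ℂ} {c : ℝ} (hγ : IsProgressivePath D ξ u c γ) (t : ℝ) :
    AccPt (γ t) (𝓟 (Set.range γ)) := by
  -- The path is not constant because `Re ((u + c) ξ)` is unbounded below on it, and a nontrivial
  -- connected set has no isolated points.
  have hnt : (Set.range γ).Nontrivial := by
    rw [← Set.not_subsingleton_iff]
    intro hsub
    obtain ⟨s, hs⟩ := (hγ.tendsto_start.eventually_lt_atBot (((u + c) * ξ (γ t)).re)).exists
    rw [hsub (Set.mem_range_self s) (Set.mem_range_self t)] at hs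
    exact lt_irrefl _ hs
  exact (isPreconnected_range hγ.isR2Path.continuous).preperfect_of_nontrivial hnt _
    (Set.mem_range_self t)

/-- The range of the path accumulates at a point of the connected set `Z`, so the identity theorem
applies. -/
theorem IsParticularSolution.eqOn_of_eq_on_path {u : ℂ} {c : ℝ} {w w' : ℂ → ℂ}
    (hw : IsParticularSolution Z f g p u w) (hw' : IsParticularSolution Z f g p u w')
    (hZ : IsOpen Z) (hZc : IsPreconnected Z) (hDZ : D ⊆ Z) (hγ : IsProgressivePath D ξ u c γ)
    (h : ∀ t, w' (γ t) = w (γ t)) : Set.EqOn w' w Z := by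
  refine AnalyticOnNhd.eqOn_of_preconnected_of_frequently_eq (hw'.1.analyticOnNhd hZ)
    (hw.1.analyticOnNhd hZ) hZc (hDZ (hγ.mem 0)) ?_
  refine (accPt_iff_frequently_nhdsNE.1 (hγ.accPt 0)).mono ?_
  rintro _ ⟨t, rfl⟩
  exact h t

end LiouvilleGreen

/-! ### The theorem -/

open LiouvilleGreen in
theorem mainTheorem5
    (Z D : Set ℂ) (f g p ξ q : ℂ → ℂ)
    (hZ : IsOpen Z) (hZsc : IsSimplyConnected Z)
    (hf : DifferentiableOn ℂ f Z) (hg : DifferentiableOn ℂ g Z) (hp : DifferentiableOn ℂ p Z)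
    (hD : IsOpen D) (hDZ : D ⊆ Z) (hξ : LiouvilleGreen.IsLiouvilleVariable D f ξ q)
    (u : ℂ) (c : ℝ) (n : ℕ) (γ : ℝ → ℂ)
    (hγ : LiouvilleGreen.IsProgressivePath D ξ u c γ)
    (hG : (fun τ => LiouvilleGreen.scaledCoeff f g p ξ q c n (γ τ))
      =O[Filter.cocompact ℝ] (fun _ => (1 : ℝ)))
    (σ : ℝ) (hσ : 1 < σ)
    (hG' : (fun τ => LiouvilleGreen.derivXi ξ (LiouvilleGreen.scaledCoeff f g p ξ q c n) (γ τ))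
      =O[Filter.cocompact ℝ] (fun τ => ‖ξ (γ τ)‖ ^ (-σ)))
    (hGint : LiouvilleGreen.PathIntegrable ξ γ
      (LiouvilleGreen.derivXi ξ (LiouvilleGreen.scaledCoeff f g p ξ q c n)))
    (hψint : LiouvilleGreen.PathIntegrable ξ γ (LiouvilleGreen.psi f g))
    (hu : max |c| (1 / 2 * LiouvilleGreen.pathIntegral ξ γ (LiouvilleGreen.psi f g)) < ‖u‖) :
    ∃ w : ℂ → ℂ, LiouvilleGreen.IsBoundedSolution Z D f g p ξ q u c n γ w ∧
      ∀ w' : ℂ → ℂ, LiouvilleGreen.IsBoundedSolution Z D f g p ξ q u c n γ w' →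
        Set.EqOn w' w Z := by
  have hc : |c| < ‖u‖ := (le_max_left _ _).trans_lt hu
  have hu0 : 0 < ‖u‖ := (abs_nonneg c).trans_lt hc
  have hune : u ≠ 0 := norm_pos_iff.1 hu0
  have hfD := hf.mono hDZ
  have hgD := hg.mono hDZ
  have hpD := hp.mono hDZ
  have cγ := hγ.isR2Path.continuous
  obtain ⟨S, hx, hγd⟩ := hγ.exists_break_points hξ hD
  have dG := hξ.differentiableOn_scaledCoeff hD hfD hgD hpD c n
  have cG : Continuous fun t => scaledCoeff f g p ξ q c n (γ t) :=
    dG.continuousOn.comp_continuous cγ hγ.mem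
  have cG' : Continuous fun t => derivXi ξ (scaledCoeff f g p ξ q c n) (γ t) :=
    (hξ.differentiableOn_derivXi hD dG).continuousOn.comp_continuous cγ hγ.mem
  have cψ : Continuous fun t => psi f g (γ t) :=
    (hξ.differentiableOn_psi hD hfD hgD).continuousOn.comp_continuous cγ hγ.mem
  have hψu : 1 / (2 * ‖u‖) * (∫ t, ‖psi f g (γ t) * deriv (fun s => ξ (γ s)) t‖) < 1 := by
    have h1 := (le_max_right _ _).trans_lt hu
    rw [pathIntegral_eq] at h1
    rw [one_div_mul_eq_div, div_lt_one (by positivity)]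
    linarith
  have hiψ := hψint.integrable cψ
  have hsol := fun w (hw : IsParticularSolution Z f g p u w) =>
    hw.isPathSolution hune hD hDZ hξ hfD hgD hpD cγ hγ.mem hx hγd c n
  -- Boundedness is needed for the supremum to dominate the values: the real supremum of an
  -- unbounded family is `0` by default.
  obtain ⟨C, hC⟩ := cG.exists_bound_of_isBigO_one hG
  have hsup : ∀ t, ‖scaledCoeff f g p ξ q c n (γ t)‖
      ≤ ⨆ τ : ℝ, ‖scaledCoeff f g p ξ q c n (γ τ)‖ :=
    le_ciSup (f := fun τ : ℝ => ‖scaledCoeff f g p ξ q c n (γ τ)‖)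
      ⟨C, by rintro _ ⟨t, rfl⟩; exact hC t⟩
  have hcancel : ∀ t, Complex.exp (c * ξ (γ t)) * Complex.exp (-c * ξ (γ t)) = 1 := fun t => by
    rw [← Complex.exp_add]; simp
  -- The forcing term here is `e^{-cξ} G_n`; the factor `u^{-2n}` is restored below by linearity.
  obtain ⟨h, k, s, hb⟩ := hx.exists_isPathSolution hc hγ.monotone_sub hγ.monotone_add cψ hiψ hψu
    cG cG' (fun t ht => hξ.hasDerivAt_comp hD dG (hγ.mem t) (hγd t ht)) (hGint.integrable cG') hsup
  obtain ⟨w, hw, hw0, hw0'⟩ := exists_isParticularSolution_remainder hZ hZsc hf hg hp hD hDZ hξ u n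
    (hγ.mem 0) (Complex.exp (c * ξ (γ 0)) * (1 / u ^ (2 * n) * h 0))
    (Complex.exp (c * ξ (γ 0)) * (1 / u ^ (2 * n) * k 0))
  have hrem : ∀ t, remainder f g p ξ q u n w (γ t)
      = Complex.exp (c * ξ (γ t)) * (1 / u ^ (2 * n) * h t) := by
    have hdiff := (hsol w hw).sub (s.const_mul (1 / u ^ (2 * n)))
    simp only [sub_self] at hdiff
    intro t
    have h0 := hdiff.eq_zero_of_initial hx cψ (t₀ := 0)
      (by rw [hw0]; linear_combination (1 / u ^ (2 * n) * h 0) * hcancel 0)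
      (by rw [hw0']; linear_combination (1 / u ^ (2 * n) * k 0) * hcancel 0) t
    linear_combination Complex.exp (c * ξ (γ t)) * h0
      - remainder f g p ξ q u n w (γ t) * hcancel t
  have hbound : ∀ t, ‖remainder f g p ξ q u n w (γ t)‖ ≤ errorBound f g p ξ q u c n γ (γ t) := by
    intro t
    rw [hrem t, norm_mul, norm_mul, norm_div, norm_one, norm_pow, ← mul_assoc, mul_one_div,
      errorBound_eq hune c hc, pathIntegral_eq, pathIntegral_eq]
    exact mul_le_mul_of_nonneg_left (hb t) (by positivity)
  refine ⟨w, ⟨hw, remainder f g p ξ q u n w, (hasExpansion_iff hξ u n w _).2 fun _ _ => rfl,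
    hbound⟩, fun w' hw' => ?_⟩
  obtain ⟨hw', ε, hε, hεb⟩ := hw'
  have hε' := (hasExpansion_iff hξ u n w' ε).1 hε
  refine hw.eqOn_of_eq_on_path hw' hZ hZsc.isPathConnected.isConnected.isPreconnected hDZ hγ
    fun t => ?_
  obtain ⟨B, hB⟩ : ∃ B, ∀ t, ∀ r : ℂ, ‖r‖ ≤ errorBound f g p ξ q u c n γ (γ t) →
      ‖Complex.exp (-c * ξ (γ t)) * r‖ ≤ B := by
    obtain ⟨B, hB⟩ := exists_errorBound_le_mul (f := f) (g := g) (p := p) (q := q) (n := n) hune hc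
      hsup
    refine ⟨B, fun t r hr => ?_⟩
    rw [norm_mul]
    refine (mul_le_mul_of_nonneg_left (hr.trans (hB t)) (norm_nonneg _)).trans_eq ?_
    rw [← mul_assoc, ← norm_mul, mul_comm (Complex.exp _), hcancel, norm_one, one_mul]
  -- Both weighted remainders are bounded, so their difference is a bounded solution of the
  -- homogeneous system.
  have hdiff := (hsol w' hw').sub (hsol w hw)
  simp only [sub_self] at hdiff
  have h0 := hdiff.eq_zero_of_bounded hx hune hγ.monotone_sub hγ.monotone_add hγ.tendsto_end
    hγ.tendsto_start cψ hiψ hψu (B := B + B) (fun t => (norm_sub_le _ _).trans (add_le_add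
      (hB t _ (by rw [hε' _ (hγ.mem t)]; exact hεb t)) (hB t _ (hbound t)))) t
  have h1 : remainder f g p ξ q u n w' (γ t) = remainder f g p ξ q u n w (γ t) := by
    rw [← mul_sub] at h0
    exact sub_eq_zero.1 ((mul_eq_zero.1 h0).resolve_left (Complex.exp_ne_zero _))
  rw [remainder, remainder, sub_left_inj] at h1
  exact mul_left_cancel₀ (hξ.q_ne_zero (hγ.mem t)) h1
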